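/- **Lemma.** Let $M=\{z=x+iy\in\mathbb C:|z|<1\}$ and $\mathbb S^1=\partial M=\{e^{i\beta}\}$; all functions are complex-valued. Let $H^1(M)$ be the usual Sobolev space, $H^1_0(M)$ the $H^1$-closure of $C_c^\infty(M)$, and $$\dot H^1(M)=\Big\{f\in H^1(M):\ \int_{\mathbb S^1} f(e^{i\beta})\,d\beta=0\Big\},$$ where the boundary values are taken in the sense of traces. With $\partial=\tfrac12(\partial_x-i\partial_y)$ and $\bar\partial=\tfrac12(\partial_x+i\partial_y)$, taken in the sense of distributions, let $$\dot H^1(\ker{}^0\eta_+,M)=\{f\in\dot H^1(M):\partial f=0\},\qquad \dot H^1(\ker{}^0\eta_-,M)=\{f\in\dot H^1(M):\bar\partial f=0\}.$$ Then there is the direct decomposition $$\dot H^1(M)=H^1_0(M)\oplus\dot H^1(\ker{}^0\eta_+,M)\oplus\dot H^1(\ker{}^0\eta_-,M).$$ Moreover, let $g\in\dot H^1(M)$. Its trace has the Fourier expansion, convergent in $L^2(\mathbb S^1)$, $$g|_{\partial M}(e^{i\beta})=\sum_{k=1}^\infty\big(a_ke^{ik\beta}+b_ke^{-ik\beta}\big),\qquad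 \sum_{k=1}^\infty(|b_k|^2+|a_k|^2)(1+k)<\infty,$$ where $a_k=\frac1{2\pi}\int_0^{2\pi}g(e^{i\beta})e^{-ik\beta}\,d\beta$ and $b_k=\frac1{2\pi}\int_0^{2\pi}g(e^{i\beta})e^{ik\beta}\,d\beta$. If $g=g_{(0)}+g_{(+)}+g_{(-)}$ with $g_{(0)}\in H^1_0(M)$ and $g_{(\pm)}\in\dot H^1(\ker{}^0\eta_\pm,M)$, then for almost every $z\in M$ $$g_{(+)}(z)=\sum_{k=1}^\infty b_k\bar z^k,\qquad g_{(-)}(z)=\sum_{k=1}^\infty a_kz^k .$$ -/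

import Mathlib

open MeasureTheory Filter Topology
open scoped ContDiff ENNReal

noncomputable section

namespace DiskSobolev

/-- The open unit disk `M`, a point `(x, y)` being identified with `z = x + i y`. -/
abbrev disk : Set ℂ := Metric.ball 0 1

/-- Lebesgue measure on the unit disk. -/
abbrev diskMeasure : Measure ℂ := volume.restrict disk

/-- The space `L²(M)` of complex-valued functions. -/
abbrev L2Disk : Type := Lp ℂ 2 diskMeasure

/-- The parameter circle `ℝ / 2πℤ` of the boundary `∂M = {e^{iβ}}`. -/
abbrev BdryCircle : Type := AddCircle (2 * Real.pi)

/-- The parameter circle has positive length. -/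
instance bdryCirclePos : Fact (0 < 2 * Real.pi) := ⟨Real.two_pi_pos⟩

/-- The normalized arc length measure `dβ / 2π` on the boundary. -/
abbrev bdryMeasure : Measure BdryCircle := AddCircle.haarAddCircle

/-- The space `L²(∂M)`. -/
abbrev L2Bdry : Type := Lp ℂ 2 bdryMeasure

/-- The boundary point `e^{iβ}`. -/
abbrev bdryPoint (β : BdryCircle) : ℂ := (AddCircle.toCircle β : ℂ)

/-- Test functions: elements of `C_c^∞(M)`. -/
structure IsTest (φ : ℂ → ℂ) : Prop where
  smooth : ContDiff ℝ ∞ φ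
  compact : HasCompactSupport φ
  support : tsupport φ ⊆ disk

/-- `g` is the weak derivative of `f` in `M` in the direction `v`
(`v = 1` for `∂_x` and `v = i` for `∂_y`). -/
def HasWeakDeriv (v : ℂ) (f g : L2Disk) : Prop :=
  ∀ φ : ℂ → ℂ, IsTest φ →
    ∫ z, f z * fderiv ℝ φ z v ∂diskMeasure = - ∫ z, g z * φ z ∂diskMeasure

/-- `∂φ = (∂_x φ - i ∂_y φ) / 2`. -/
def wirtinger (φ : ℂ → ℂ) (z : ℂ) : ℂ :=
  (1 / 2) * (fderiv ℝ φ z 1 - Complex.I * fderiv ℝ φ z Complex.I)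

/-- `∂̄φ = (∂_x φ + i ∂_y φ) / 2`. -/
def wirtingerBar (φ : ℂ → ℂ) (z : ℂ) : ℂ :=
  (1 / 2) * (fderiv ℝ φ z 1 + Complex.I * fderiv ℝ φ z Complex.I)

/-- Convergence in the norm of `H¹(M)` of smooth functions `u n` to `f`: the functions and their
first partial derivatives converge in `L²(M)` to `f` and its weak partial derivatives. -/
def TendstoH1 (u : ℕ → ℂ → ℂ) (f : L2Disk) : Prop :=
  Tendsto (fun n => eLpNorm (fun z => u n z - f z) 2 diskMeasure) atTop (𝓝 0) ∧
  ∃ fx fy : L2Disk, HasWeakDeriv 1 f fx ∧ HasWeakDeriv Complex.I f fy ∧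
    Tendsto (fun n => eLpNorm (fun z => fderiv ℝ (u n) z 1 - fx z) 2 diskMeasure) atTop (𝓝 0) ∧
    Tendsto (fun n => eLpNorm (fun z => fderiv ℝ (u n) z Complex.I - fy z) 2 diskMeasure)
      atTop (𝓝 0)

/-- `t ∈ L²(∂M)` is the boundary trace of `f`: the trace is the extension by continuity, with
respect to the `H¹(M)` norm and the `L²(∂M)` norm, of the restriction to `∂M` of functions that
are smooth up to the boundary. -/
def IsTrace (f : L2Disk) (t : L2Bdry) : Prop :=
  ∃ u : ℕ → ℂ → ℂ, (∀ n, ContDiff ℝ ∞ (u n)) ∧ TendstoH1 u f ∧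
    Tendsto (fun n => eLpNorm (fun β => u n (bdryPoint β) - t β) 2 bdryMeasure) atTop (𝓝 0)

section Helpers

theorem IsTest.memLp {φ : ℂ → ℂ} (h : IsTest φ) : MemLp φ 2 diskMeasure :=
  (h.smooth.continuous.memLp_of_hasCompactSupport h.compact).restrict disk

theorem IsTest.memLp_fderiv {φ : ℂ → ℂ} (h : IsTest φ) (v : ℂ) :
    MemLp (fun z => fderiv ℝ φ z v) 2 diskMeasure :=
  (((h.smooth.continuous_fderiv (by simp)).clm_apply
    continuous_const).memLp_of_hasCompactSupport (h.compact.fderiv_apply ℝ v)).restrict disk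

theorem integrable_mul_test (f : L2Disk) {ψ : ℂ → ℂ} (h : MemLp ψ 2 diskMeasure) :
    Integrable (fun z => f z * ψ z) diskMeasure :=
  (Lp.memLp f).integrable_mul h

theorem integral_add_mul (f g : L2Disk) {ψ : ℂ → ℂ} (h : MemLp ψ 2 diskMeasure) :
    ∫ z, (f + g : L2Disk) z * ψ z ∂diskMeasure =
      ∫ z, f z * ψ z ∂diskMeasure + ∫ z, g z * ψ z ∂diskMeasure := by
  rw [← integral_add (integrable_mul_test f h) (integrable_mul_test g h)]
  refine integral_congr_ae ?_
  filter_upwards [Lp.coeFn_add f g] with z hz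
  rw [hz, Pi.add_apply, add_mul]

theorem integral_smul_mul (c : ℂ) (f : L2Disk) (ψ : ℂ → ℂ) :
    ∫ z, (c • f : L2Disk) z * ψ z ∂diskMeasure = c * ∫ z, f z * ψ z ∂diskMeasure := by
  rw [← integral_const_mul]
  refine integral_congr_ae ?_
  filter_upwards [Lp.coeFn_smul c f] with z hz
  rw [hz, Pi.smul_apply, smul_eq_mul, mul_assoc]

theorem HasWeakDeriv.add {v : ℂ} {f g f' g' : L2Disk} (hf : HasWeakDeriv v f f')
    (hg : HasWeakDeriv v g g') : HasWeakDeriv v (f + g) (f' + g') := by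
  intro φ hφ
  rw [integral_add_mul _ _ (hφ.memLp_fderiv v), integral_add_mul _ _ hφ.memLp, hf φ hφ, hg φ hφ]
  ring

theorem HasWeakDeriv.smul {v : ℂ} (c : ℂ) {f f' : L2Disk} (hf : HasWeakDeriv v f f') :
    HasWeakDeriv v (c • f) (c • f') := by
  intro φ hφ
  rw [integral_smul_mul, integral_smul_mul, hf φ hφ]
  ring

theorem HasWeakDeriv.zero (v : ℂ) : HasWeakDeriv v 0 0 := by
  simpa using HasWeakDeriv.smul (v := v) 0 (f := 0) (f' := 0) (by
    intro φ hφ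
    have h : ∀ ψ : ℂ → ℂ, ∫ z, (0 : L2Disk) z * ψ z ∂diskMeasure = 0 := fun ψ => by
      simpa using integral_smul_mul 0 (0 : L2Disk) ψ
    rw [h, h, neg_zero])

theorem tendsto_eLpNorm_add {α : Type*} [MeasurableSpace α] {μ : Measure α}
    {u v w : ℕ → α → ℂ} {f g : Lp ℂ 2 μ}
    (hum : ∀ n, AEStronglyMeasurable (u n) μ) (hvm : ∀ n, AEStronglyMeasurable (v n) μ)
    (hw : ∀ n z, w n z = u n z + v n z)
    (hu : Tendsto (fun n => eLpNorm (fun z => u n z - f z) 2 μ) atTop (𝓝 0))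
    (hv : Tendsto (fun n => eLpNorm (fun z => v n z - g z) 2 μ) atTop (𝓝 0)) :
    Tendsto (fun n => eLpNorm (fun z => w n z - (f + g : Lp ℂ 2 μ) z) 2 μ) atTop (𝓝 0) := by
  have h := hu.add hv
  rw [add_zero] at h
  refine tendsto_of_tendsto_of_tendsto_of_le_of_le tendsto_const_nhds h (fun _ => zero_le) ?_
  intro n
  refine le_trans (le_of_eq (eLpNorm_congr_ae ?_)) (eLpNorm_add_le
    ((hum n).sub (Lp.aestronglyMeasurable f)) ((hvm n).sub (Lp.aestronglyMeasurable g)) (by simp))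
  filter_upwards [Lp.coeFn_add f g] with z hz
  simp only [hz, hw, Pi.add_apply]
  ring

theorem tendsto_eLpNorm_smul {α : Type*} [MeasurableSpace α] {μ : Measure α} (c : ℂ)
    {u w : ℕ → α → ℂ} {f : Lp ℂ 2 μ} (hw : ∀ n z, w n z = c * u n z)
    (hu : Tendsto (fun n => eLpNorm (fun z => u n z - f z) 2 μ) atTop (𝓝 0)) :
    Tendsto (fun n => eLpNorm (fun z => w n z - (c • f : Lp ℂ 2 μ) z) 2 μ) atTop (𝓝 0) := by
  have h := ENNReal.Tendsto.const_mul (a := ‖c‖ₑ) hu (Or.inr (by simp))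
  rw [mul_zero] at h
  refine h.congr fun n => ?_
  rw [← eLpNorm_const_smul]
  refine eLpNorm_congr_ae ?_
  filter_upwards [Lp.coeFn_smul c f] with z hz
  simp only [hz, hw, Pi.smul_apply, smul_eq_mul]
  ring

theorem aesm_fderiv {u : ℂ → ℂ} (hu : ContDiff ℝ ∞ u) (v : ℂ) (μ : Measure ℂ) :
    AEStronglyMeasurable (fun z => fderiv ℝ u z v) μ :=
  ((hu.continuous_fderiv (by simp)).clm_apply continuous_const).aestronglyMeasurable

theorem TendstoH1.add {u v : ℕ → ℂ → ℂ} {f g : L2Disk} (hus : ∀ n, ContDiff ℝ ∞ (u n))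
    (hvs : ∀ n, ContDiff ℝ ∞ (v n)) (hu : TendstoH1 u f) (hv : TendstoH1 v g) :
    TendstoH1 (fun n => u n + v n) (f + g) := by
  obtain ⟨h0, fx, fy, hx, hy, h1, h2⟩ := hu
  obtain ⟨k0, gx, gy, kx, ky, k1, k2⟩ := hv
  have hd : ∀ n z w, fderiv ℝ (u n + v n) z w = fderiv ℝ (u n) z w + fderiv ℝ (v n) z w := by
    intro n z w
    rw [fderiv_add ((hus n).differentiable (by simp) z) ((hvs n).differentiable (by simp) z)]
    rfl
  exact ⟨tendsto_eLpNorm_add (fun n => (hus n).continuous.aestronglyMeasurable)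
      (fun n => (hvs n).continuous.aestronglyMeasurable) (fun _ _ => rfl) h0 k0,
    fx + gx, fy + gy, hx.add kx, hy.add ky,
    tendsto_eLpNorm_add (fun n => aesm_fderiv (hus n) _ _) (fun n => aesm_fderiv (hvs n) _ _)
      (fun n z => hd n z _) h1 k1,
    tendsto_eLpNorm_add (fun n => aesm_fderiv (hus n) _ _) (fun n => aesm_fderiv (hvs n) _ _)
      (fun n z => hd n z _) h2 k2⟩

theorem TendstoH1.smul (c : ℂ) {u : ℕ → ℂ → ℂ} {f : L2Disk} (hus : ∀ n, ContDiff ℝ ∞ (u n))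
    (hu : TendstoH1 u f) : TendstoH1 (fun n => c • u n) (c • f) := by
  obtain ⟨h0, fx, fy, hx, hy, h1, h2⟩ := hu
  have hd : ∀ n z w, fderiv ℝ (c • u n) z w = c * fderiv ℝ (u n) z w := by
    intro n z w
    rw [fderiv_const_smul ((hus n).differentiable (by simp) z)]
    rfl
  exact ⟨tendsto_eLpNorm_smul c (fun _ _ => rfl) h0, c • fx, c • fy, hx.smul c, hy.smul c,
    tendsto_eLpNorm_smul c (fun n z => hd n z _) h1,
    tendsto_eLpNorm_smul c (fun n z => hd n z _) h2⟩

theorem eLpNorm_zero_sub {α : Type*} [MeasurableSpace α] (μ : Measure α) :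
    eLpNorm (fun z => (0 : ℂ) - (0 : Lp ℂ 2 μ) z) 2 μ = 0 := by
  have : (fun z => (0 : ℂ) - (0 : Lp ℂ 2 μ) z) =ᵐ[μ] 0 := by
    filter_upwards [Lp.coeFn_zero ℂ 2 μ] with z hz
    rw [hz, Pi.zero_apply, sub_zero]
  rw [eLpNorm_congr_ae this, eLpNorm_zero]

theorem TendstoH1.zero : TendstoH1 (fun _ => 0) 0 := by
  have h : Tendsto (fun _ : ℕ => eLpNorm (fun z => (0 : ℂ) - (0 : L2Disk) z) 2 diskMeasure)
      atTop (𝓝 0) := by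
    rw [eLpNorm_zero_sub]
    exact tendsto_const_nhds
  have hd : ∀ z v : ℂ, fderiv ℝ (0 : ℂ → ℂ) z v = 0 := by simp
  refine ⟨h, 0, 0, HasWeakDeriv.zero _, HasWeakDeriv.zero _, ?_, ?_⟩ <;>
    simpa only [hd] using h

theorem IsTest.zero : IsTest 0 :=
  ⟨contDiff_const, HasCompactSupport.zero, by simp [tsupport]⟩

theorem IsTest.add {φ ψ : ℂ → ℂ} (hφ : IsTest φ) (hψ : IsTest ψ) : IsTest (φ + ψ) :=
  ⟨hφ.smooth.add hψ.smooth, hφ.compact.add hψ.compact,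
    (tsupport_add φ ψ).trans (Set.union_subset hφ.support hψ.support)⟩

theorem IsTest.smul (c : ℂ) {φ : ℂ → ℂ} (hφ : IsTest φ) : IsTest (c • φ) :=
  ⟨hφ.smooth.const_smul c, hφ.compact.smul_left (f := fun _ => c),
    (tsupport_smul_subset_right (fun _ => c) φ).trans hφ.support⟩

theorem IsTrace.zero : IsTrace 0 0 :=
  ⟨fun _ => 0, fun _ => contDiff_const, TendstoH1.zero, by
    refine Tendsto.congr (fun _ => (eLpNorm_zero_sub bdryMeasure).symm) tendsto_const_nhds⟩

theorem continuous_bdryPoint : Continuous bdryPoint :=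
  continuous_subtype_val.comp AddCircle.continuous_toCircle

theorem IsTrace.add {f g : L2Disk} {s t : L2Bdry} (hf : IsTrace f s) (hg : IsTrace g t) :
    IsTrace (f + g) (s + t) := by
  obtain ⟨u, hus, hu, hub⟩ := hf
  obtain ⟨v, hvs, hv, hvb⟩ := hg
  exact ⟨fun n => u n + v n, fun n => (hus n).add (hvs n), hu.add hus hvs hv,
    tendsto_eLpNorm_add
      (fun n => ((hus n).continuous.comp continuous_bdryPoint).aestronglyMeasurable)
      (fun n => ((hvs n).continuous.comp continuous_bdryPoint).aestronglyMeasurable)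
      (fun _ _ => rfl) hub hvb⟩

theorem IsTrace.smul (c : ℂ) {f : L2Disk} {t : L2Bdry} (hf : IsTrace f t) :
    IsTrace (c • f) (c • t) := by
  obtain ⟨u, hus, hu, hub⟩ := hf
  exact ⟨fun n => c • u n, fun n => (hus n).const_smul c, hu.smul c hus,
    tendsto_eLpNorm_smul c (fun _ _ => rfl) hub⟩

theorem IsTest.memLp_wirtinger {φ : ℂ → ℂ} (h : IsTest φ) : MemLp (wirtinger φ) 2 diskMeasure :=
  ((h.memLp_fderiv 1).sub ((h.memLp_fderiv Complex.I).const_mul Complex.I)).const_mul (1 / 2)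

theorem IsTest.memLp_wirtingerBar {φ : ℂ → ℂ} (h : IsTest φ) :
    MemLp (wirtingerBar φ) 2 diskMeasure :=
  ((h.memLp_fderiv 1).add ((h.memLp_fderiv Complex.I).const_mul Complex.I)).const_mul (1 / 2)

end Helpers

/-- The Sobolev space `H¹(M)`. -/
def H1 : Submodule ℂ L2Disk where
  carrier := {f | ∃ fx fy : L2Disk, HasWeakDeriv 1 f fx ∧ HasWeakDeriv Complex.I f fy}
  zero_mem' := ⟨0, 0, HasWeakDeriv.zero _, HasWeakDeriv.zero _⟩
  add_mem' := by
    rintro f g ⟨fx, fy, hx, hy⟩ ⟨gx, gy, kx, ky⟩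
    exact ⟨fx + gx, fy + gy, hx.add kx, hy.add ky⟩
  smul_mem' := by
    rintro c f ⟨fx, fy, hx, hy⟩
    exact ⟨c • fx, c • fy, hx.smul c, hy.smul c⟩

/-- The space `H¹₀(M)`, the closure of `C_c^∞(M)` in `H¹(M)`. -/
def H10 : Submodule ℂ L2Disk where
  carrier := {f | ∃ u : ℕ → ℂ → ℂ, (∀ n, IsTest (u n)) ∧ TendstoH1 u f}
  zero_mem' := ⟨fun _ => 0, fun _ => IsTest.zero, TendstoH1.zero⟩
  add_mem' := by
    rintro f g ⟨u, hus, hu⟩ ⟨v, hvs, hv⟩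
    exact ⟨fun n => u n + v n, fun n => (hus n).add (hvs n),
      hu.add (fun n => (hus n).smooth) (fun n => (hvs n).smooth) hv⟩
  smul_mem' := by
    rintro c f ⟨u, hus, hu⟩
    exact ⟨fun n => c • u n, fun n => (hus n).smul c, hu.smul c (fun n => (hus n).smooth)⟩

/-- The space `Ḣ¹(M)` of elements of `H¹(M)` whose boundary trace has integral zero. -/
def H1dot : Submodule ℂ L2Disk where
  carrier := {f | f ∈ H1 ∧ ∃ t : L2Bdry, IsTrace f t ∧ ∫ β, t β ∂bdryMeasure = 0}
  zero_mem' := ⟨H1.zero_mem, 0, IsTrace.zero, by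
    rw [integral_congr_ae (Lp.coeFn_zero ℂ 2 bdryMeasure)]; simp⟩
  add_mem' := by
    rintro f g ⟨hf, s, hs, hs0⟩ ⟨hg, t, ht, ht0⟩
    refine ⟨H1.add_mem hf hg, s + t, hs.add ht, ?_⟩
    rw [integral_congr_ae (Lp.coeFn_add s t)]
    simp only [Pi.add_apply]
    rw [integral_add ((Lp.memLp s).integrable (by simp)) ((Lp.memLp t).integrable (by simp)),
      hs0, ht0, add_zero]
  smul_mem' := by
    rintro c f ⟨hf, t, ht, ht0⟩
    refine ⟨H1.smul_mem c hf, c • t, ht.smul c, ?_⟩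
    rw [integral_congr_ae (Lp.coeFn_smul c t)]
    simp only [Pi.smul_apply]
    rw [integral_smul, ht0, smul_zero]

/-- `ker⁰ η₊`: the functions `f ∈ L²(M)` with `∂f = 0` in the sense of distributions. -/
def ker0EtaPlus : Submodule ℂ L2Disk where
  carrier := {f | ∀ φ : ℂ → ℂ, IsTest φ → ∫ z, f z * wirtinger φ z ∂diskMeasure = 0}
  zero_mem' := fun φ _ => by simpa using integral_smul_mul 0 (0 : L2Disk) (wirtinger φ)
  add_mem' := by
    intro f g hf hg φ hφ
    rw [integral_add_mul _ _ hφ.memLp_wirtinger, hf φ hφ, hg φ hφ, add_zero]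
  smul_mem' := by
    intro c f hf φ hφ
    rw [integral_smul_mul, hf φ hφ, mul_zero]

/-- `ker⁰ η₋`: the functions `f ∈ L²(M)` with `∂̄f = 0` in the sense of distributions. -/
def ker0EtaMinus : Submodule ℂ L2Disk where
  carrier := {f | ∀ φ : ℂ → ℂ, IsTest φ → ∫ z, f z * wirtingerBar φ z ∂diskMeasure = 0}
  zero_mem' := fun φ _ => by simpa using integral_smul_mul 0 (0 : L2Disk) (wirtingerBar φ)
  add_mem' := by
    intro f g hf hg φ hφ
    rw [integral_add_mul _ _ hφ.memLp_wirtingerBar, hf φ hφ, hg φ hφ, add_zero]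
  smul_mem' := by
    intro c f hf φ hφ
    rw [integral_smul_mul, hf φ hφ, mul_zero]

/-- `Ḣ¹(ker⁰ η₊, M) = Ḣ¹(M) ∩ ker⁰ η₊`. -/
def H1dotKerPlus : Submodule ℂ L2Disk := H1dot ⊓ ker0EtaPlus

/-- `Ḣ¹(ker⁰ η₋, M) = Ḣ¹(M) ∩ ker⁰ η₋`. -/
def H1dotKerMinus : Submodule ℂ L2Disk := H1dot ⊓ ker0EtaMinus

end DiskSobolev

end

/-! The decomposition is read off the boundary. An element of `H1dot` has a trace, hence
approximants smooth up to the circle, so identities are proved for smooth functions and passed to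
the limit in L². Green's formula for ∂_x + κ∂_y with κ = ±i, tested on the monomials z^a z̄^b, is
the main instrument. It expresses every Fourier coefficient of the trace by interior integrals
(`IsTrace.fourierCoeff_eq`), and four facts follow.

Traces are unique. A solution of ∂̄f = 0 (resp. ∂f = 0) has a trace without negative (resp.
positive) frequencies. Such a solution with zero trace is orthogonal to all monomials, hence zero by
Stone–Weierstrass. Finally, Bessel's inequality for the orthogonal powers z^k bounds ∑ k|t̂(±k)|² by
the L² norm of the gradient.

Conversely, this H^{1/2} decay is exactly what makes ∑ a_k z^k converge in H¹ (`exists_series`).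
Subtracting from g the two series built from the positive and negative frequencies of its trace
leaves a function of trace zero. It lies in H¹₀ (`IsTrace.mem_H10`): cutting off in a boundary layer
of width δ costs a gradient of size 1/δ, which a Hardy type inequality compensates. Directness and
the formulas hold because elements of the kernels are determined by their traces, and the two
kernels occupy disjoint sets of frequencies.

Both kernels are treated at once through a map c, the identity or the conjugation, with sign σ. -/

noncomputable section

namespace DiskSobolev

/-! ### Polar coordinates and Green's formula on the disk -/

/-- The point with polar coordinates `(r, θ)`. -/
def polarPoint (p : ℝ × ℝ) : ℂ := p.1 * (Real.cos p.2 + Real.sin p.2 * Complex.I)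

theorem contDiff_polarPoint : ContDiff ℝ ∞ polarPoint := by
  unfold polarPoint
  have h : ContDiff ℝ ∞ (fun x : ℝ => (x : ℂ)) := Complex.ofRealCLM.contDiff
  exact (h.comp contDiff_fst).mul (((h.comp Real.contDiff_cos).comp contDiff_snd).add
    (((h.comp Real.contDiff_sin).comp contDiff_snd).mul contDiff_const))

theorem hasFDerivAt_polarPoint (p : ℝ × ℝ) : ∃ L : ℝ × ℝ →L[ℝ] ℂ, HasFDerivAt polarPoint L p ∧
    L (1, 0) = Real.cos p.2 + Real.sin p.2 * Complex.I ∧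
    L (0, 1) = p.1 * (-Real.sin p.2 + Real.cos p.2 * Complex.I) := by
  have h1 : HasFDerivAt (fun p : ℝ × ℝ => (p.1 : ℂ)) (Complex.ofRealCLM ∘L .fst ℝ ℝ ℝ) p :=
    Complex.ofRealCLM.hasFDerivAt.comp p hasFDerivAt_fst
  have h2 : HasFDerivAt (fun p : ℝ × ℝ => (Real.cos p.2 : ℂ)) _ p :=
    Complex.ofRealCLM.hasFDerivAt.comp p
      ((Real.hasDerivAt_cos p.2).hasFDerivAt.comp p hasFDerivAt_snd)
  have h3 : HasFDerivAt (fun p : ℝ × ℝ => (Real.sin p.2 : ℂ)) _ p :=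
    Complex.ofRealCLM.hasFDerivAt.comp p
      ((Real.hasDerivAt_sin p.2).hasFDerivAt.comp p hasFDerivAt_snd)
  refine ⟨_, h1.mul (h2.add (h3.mul_const Complex.I)), ?_, ?_⟩
  · simp
  · simp; ring

theorem polarPoint_eq (p : ℝ × ℝ) : polarPoint p = Complex.polarCoord.symm p := by
  rw [Complex.polarCoord_symm_apply]; rfl

theorem norm_polarPoint (p : ℝ × ℝ) : ‖polarPoint p‖ = |p.1| := by
  rw [polarPoint_eq, Complex.norm_polarCoord_symm]

theorem polarPoint_eq_exp (p : ℝ × ℝ) : polarPoint p = p.1 * Complex.exp (p.2 * Complex.I) := by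
  rw [polarPoint, Complex.exp_mul_I, Complex.ofReal_cos, Complex.ofReal_sin]

/-- Integration over the disk in polar coordinates. -/
theorem integral_disk_polar {F : ℂ → ℂ} (hF : Continuous F) :
    ∫ z, F z ∂diskMeasure =
      ∫ r in (0 : ℝ)..1, ∫ θ in (-Real.pi)..Real.pi, r * F (polarPoint (r, θ)) := by
  have hm : MeasurableSet disk := measurableSet_ball
  rw [← integral_indicator hm, ← Complex.integral_comp_polarCoord_symm]
  have hS : MeasurableSet (Set.Ioo (0 : ℝ) 1 ×ˢ Set.Ioo (-Real.pi) Real.pi) :=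
    measurableSet_Ioo.prod measurableSet_Ioo
  have hT : MeasurableSet polarCoord.target := polarCoord.open_target.measurableSet
  have hc : Continuous fun p : ℝ × ℝ => (p.1 : ℂ) * F (polarPoint p) :=
    (Complex.continuous_ofReal.comp continuous_fst).mul
      (hF.comp contDiff_polarPoint.continuous)
  have key : ∫ p in polarCoord.target, p.1 • disk.indicator F (Complex.polarCoord.symm p) =
      ∫ p in Set.Ioo (0 : ℝ) 1 ×ˢ Set.Ioo (-Real.pi) Real.pi, (p.1 : ℂ) * F (polarPoint p) := by
    rw [← integral_indicator hT, ← integral_indicator hS]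
    congr 1
    ext p
    by_cases hp : p ∈ polarCoord.target
    · rw [Set.indicator_of_mem hp, ← polarPoint_eq]
      rw [polarCoord_target, Set.mem_prod] at hp
      by_cases h1 : p.1 < 1
      · rw [Set.indicator_of_mem, Set.indicator_of_mem, Complex.real_smul]
        · exact ⟨⟨hp.1, h1⟩, hp.2⟩
        · rw [mem_ball_zero_iff, norm_polarPoint, abs_of_pos hp.1]; exact h1
      · rw [Set.indicator_of_notMem, Set.indicator_of_notMem, smul_zero]
        · exact fun h => h1 h.1.2
        · rw [mem_ball_zero_iff, norm_polarPoint, abs_of_pos hp.1]; exact h1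
    · rw [Set.indicator_of_notMem hp, Set.indicator_of_notMem]
      exact fun h => hp ⟨h.1.1, h.2⟩
  rw [key, Measure.volume_eq_prod, setIntegral_prod]
  · rw [intervalIntegral.integral_of_le zero_le_one, ← integral_Ioc_eq_integral_Ioo]
    refine integral_congr_ae (Eventually.of_forall fun r => ?_)
    simp only
    rw [intervalIntegral.integral_of_le (by linarith [Real.pi_pos]), ← integral_Ioc_eq_integral_Ioo]
  · refine (hc.continuousOn.integrableOn_compact
      ((isCompact_Icc (a := (0 : ℝ)) (b := 1)).prod
        (isCompact_Icc (a := -Real.pi) (b := Real.pi)))).mono_set ?_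
    exact Set.prod_mono Set.Ioo_subset_Icc_self Set.Ioo_subset_Icc_self

theorem fderiv_apply_eq (L : ℂ →L[ℝ] ℂ) (z : ℂ) : L z = z.re * L 1 + z.im * L Complex.I := by
  have h : z = z.re • (1 : ℂ) + z.im • Complex.I := by simp
  conv_lhs => rw [h]
  rw [map_add, map_smul, map_smul, Complex.real_smul, Complex.real_smul]

/-- Green's formula on the disk. -/
theorem integral_disk_deriv (κ : ℂ) {w : ℂ → ℂ} (hw : ContDiff ℝ ∞ w) :
    ∫ z, (fderiv ℝ w z 1 + κ * fderiv ℝ w z Complex.I) ∂diskMeasure =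
      ∫ θ in (-Real.pi)..Real.pi, (Real.cos θ + κ * Real.sin θ) * w (polarPoint (1, θ)) := by
  have hcont : Continuous fun z => fderiv ℝ w z 1 + κ * fderiv ℝ w z Complex.I := by
    have h := hw.continuous_fderiv (by simp)
    exact (h.clm_apply continuous_const).add (continuous_const.mul (h.clm_apply continuous_const))
  rw [integral_disk_polar hcont]
  -- In polar coordinates r(∂_x + κ∂_y)w is the divergence of the field (f, g) in the variables (r,
  -- θ), so the divergence theorem on the rectangle [0, 1] × [-π, π] applies.
  set f : ℝ × ℝ → ℂ := fun p => p.1 * ((Real.cos p.2 + κ * Real.sin p.2) * w (polarPoint p))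
  set g : ℝ × ℝ → ℂ := fun p => (-Real.sin p.2 + κ * Real.cos p.2) * w (polarPoint p)
  have ho : ContDiff ℝ ∞ (fun x : ℝ => (x : ℂ)) := Complex.ofRealCLM.contDiff
  have hs := (ho.comp Real.contDiff_sin).comp (contDiff_snd (E := ℝ) (F := ℝ))
  have hc := (ho.comp Real.contDiff_cos).comp (contDiff_snd (E := ℝ) (F := ℝ))
  have hW : ContDiff ℝ ∞ (fun p => w (polarPoint p)) := hw.comp contDiff_polarPoint
  have hf : ContDiff ℝ ∞ f := (ho.comp contDiff_fst).mul ((hc.add (contDiff_const.mul hs)).mul hW)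
  have hg : ContDiff ℝ ∞ g := (hs.neg.add (contDiff_const.mul hc)).mul hW
  have hdiv : ∀ p : ℝ × ℝ, fderiv ℝ f p (1, 0) + fderiv ℝ g p (0, 1) =
      p.1 * (fderiv ℝ w (polarPoint p) 1 + κ * fderiv ℝ w (polarPoint p) Complex.I) := by
    intro p
    obtain ⟨L, hL, hL1, hL2⟩ := hasFDerivAt_polarPoint p
    have hwp : HasFDerivAt (fun p => w (polarPoint p)) _ p :=
      (hw.differentiable (by simp) (polarPoint p)).hasFDerivAt.comp p hL
    have h1 : HasFDerivAt (fun p : ℝ × ℝ => (p.1 : ℂ)) (Complex.ofRealCLM ∘L .fst ℝ ℝ ℝ) p :=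
      Complex.ofRealCLM.hasFDerivAt.comp p hasFDerivAt_fst
    have h2 : HasFDerivAt (fun p : ℝ × ℝ => (Real.cos p.2 : ℂ)) _ p :=
      Complex.ofRealCLM.hasFDerivAt.comp p
        ((Real.hasDerivAt_cos p.2).hasFDerivAt.comp p hasFDerivAt_snd)
    have h3 : HasFDerivAt (fun p : ℝ × ℝ => (Real.sin p.2 : ℂ)) _ p :=
      Complex.ofRealCLM.hasFDerivAt.comp p
        ((Real.hasDerivAt_sin p.2).hasFDerivAt.comp p hasFDerivAt_snd)
    have hf' : HasFDerivAt f _ p := h1.mul ((h2.add (h3.const_mul κ)).mul hwp)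
    have hg' : HasFDerivAt g _ p := (h3.neg.add (h2.const_mul κ)).mul hwp
    rw [hf'.fderiv, hg'.fderiv]
    simp only [add_apply, smul_apply,
      ContinuousLinearMap.comp_apply, neg_apply, hL1, hL2]
    rw [fderiv_apply_eq (fderiv ℝ w (polarPoint p)) (Real.cos p.2 + Real.sin p.2 * Complex.I),
      fderiv_apply_eq (fderiv ℝ w (polarPoint p))
        (p.1 * (-Real.sin p.2 + Real.cos p.2 * Complex.I))]
    have hsc : (Real.sin p.2 : ℂ) ^ 2 + (Real.cos p.2 : ℂ) ^ 2 = 1 := by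
      exact_mod_cast Real.sin_sq_add_cos_sq p.2
    simp [-Complex.ofReal_sin, -Complex.ofReal_cos]
    linear_combination (p.1 * (fderiv ℝ w (polarPoint p) 1 +
      κ * fderiv ℝ w (polarPoint p) Complex.I)) * hsc
  have hcd : Continuous fun p : ℝ × ℝ => fderiv ℝ f p (1, 0) + fderiv ℝ g p (0, 1) :=
    ((hf.continuous_fderiv (by simp)).clm_apply continuous_const).add
      ((hg.continuous_fderiv (by simp)).clm_apply continuous_const)
  have key := integral2_divergence_prod_of_hasFDerivAt_off_countable f g (fderiv ℝ f) (fderiv ℝ g)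
    0 (-Real.pi) 1 Real.pi ∅ Set.countable_empty hf.continuous.continuousOn
    hg.continuous.continuousOn
    (fun x _ => (hf.differentiable (by simp) x).hasFDerivAt)
    (fun x _ => (hg.differentiable (by simp) x).hasFDerivAt)
    (hcd.continuousOn.integrableOn_compact (isCompact_uIcc.prod isCompact_uIcc))
  simp only [hdiv] at key
  rw [key]
  -- The side r = 0 contributes nothing because of the factor r in f, and the sides θ = ±π cancel by
  -- periodicity.
  simp [f, g, polarPoint]

/-- Integrals over the parameter circle in terms of the angle. -/
theorem integral_bdry (F : BdryCircle → ℂ) :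
    ∫ θ in (-Real.pi)..Real.pi, F (θ : ℝ) = 2 * Real.pi * ∫ β, F β ∂bdryMeasure := by
  have h := AddCircle.intervalIntegral_preimage (2 * Real.pi) (-Real.pi) F
  rw [show -Real.pi + 2 * Real.pi = Real.pi by ring] at h
  rw [h, AddCircle.integral_haarAddCircle, Complex.real_smul, ← mul_assoc]
  push_cast
  rw [mul_inv_cancel₀ (by simp [Real.pi_ne_zero]), one_mul]

theorem bdryPoint_coe (θ : ℝ) : bdryPoint (θ : BdryCircle) = polarPoint (1, θ) := by
  simp [bdryPoint, AddCircle.toCircle_apply_mk, polarPoint_eq_exp]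

/-- Green's formula on the disk, in terms of the boundary measure. -/
theorem integral_disk_deriv_bdry (κ : ℂ) {w : ℂ → ℂ} (hw : ContDiff ℝ ∞ w) :
    ∫ z, (fderiv ℝ w z 1 + κ * fderiv ℝ w z Complex.I) ∂diskMeasure =
      2 * Real.pi * ∫ β, ((bdryPoint β).re + κ * (bdryPoint β).im) * w (bdryPoint β)
        ∂bdryMeasure := by
  rw [integral_disk_deriv κ hw, ← integral_bdry]
  refine intervalIntegral.integral_congr fun θ _ => ?_
  have h : polarPoint (1, θ) = ⟨Real.cos θ, Real.sin θ⟩ := by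
    apply Complex.ext <;> simp [polarPoint, -Complex.ofReal_cos, -Complex.ofReal_sin]
  simp only [bdryPoint_coe, h]

/-! ### Limits of integrals in L² and weak derivatives -/

section Limits

variable {α : Type*} [MeasurableSpace α] {μ : Measure α}

theorem tendsto_toLp {u : ℕ → α → ℂ} {f : Lp ℂ 2 μ} (hu : ∀ n, MemLp (u n) 2 μ)
    (h : Tendsto (fun n => eLpNorm (fun z => u n z - f z) 2 μ) atTop (𝓝 0)) :
    Tendsto (fun n => (hu n).toLp (u n)) atTop (𝓝 f) := by
  rw [Lp.tendsto_Lp_iff_tendsto_eLpNorm']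
  refine h.congr fun n => eLpNorm_congr_ae ?_
  filter_upwards [(hu n).coeFn_toLp] with z hz
  rw [Pi.sub_apply, hz]

theorem tendsto_eLpNorm_of_tendsto {u : ℕ → α → ℂ} {f : Lp ℂ 2 μ} {U : ℕ → Lp ℂ 2 μ}
    (hU : ∀ n, U n =ᵐ[μ] u n) (h : Tendsto U atTop (𝓝 f)) :
    Tendsto (fun n => eLpNorm (fun z => u n z - f z) 2 μ) atTop (𝓝 0) := by
  rw [Lp.tendsto_Lp_iff_tendsto_eLpNorm'] at h
  refine h.congr fun n => eLpNorm_congr_ae ?_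
  filter_upwards [hU n] with z hz
  rw [Pi.sub_apply, hz]

/-- Integration against a fixed `L²` function, as a continuous linear functional on `L²`. -/
def pairing {ψ : α → ℂ} (hψ : MemLp ψ 2 μ) : Lp ℂ 2 μ →L[ℂ] ℂ :=
  innerSL ℂ (hψ.star.toLp (star ψ))

theorem pairing_apply {ψ : α → ℂ} (hψ : MemLp ψ 2 μ) (f : Lp ℂ 2 μ) :
    pairing hψ f = ∫ z, f z * ψ z ∂μ := by
  rw [pairing, innerSL_apply_apply, L2.inner_def]
  refine integral_congr_ae ?_
  filter_upwards [hψ.star.coeFn_toLp] with z hz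
  simp [hz, RCLike.inner_apply]

theorem integral_toLp_mul {u : α → ℂ} (hu : MemLp u 2 μ) (ψ : α → ℂ) :
    ∫ z, hu.toLp u z * ψ z ∂μ = ∫ z, u z * ψ z ∂μ := by
  refine integral_congr_ae ?_
  filter_upwards [hu.coeFn_toLp] with z hz
  rw [hz]

/-- Continuity of `pairing`; this carries identities from smooth approximants to their L² limits. -/
theorem tendsto_integral_mul {u : ℕ → α → ℂ} {f : Lp ℂ 2 μ} (hu : ∀ n, MemLp (u n) 2 μ)
    (h : Tendsto (fun n => eLpNorm (fun z => u n z - f z) 2 μ) atTop (𝓝 0))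
    {ψ : α → ℂ} (hψ : MemLp ψ 2 μ) :
    Tendsto (fun n => ∫ z, u n z * ψ z ∂μ) atTop (𝓝 (∫ z, f z * ψ z ∂μ)) := by
  have := ((pairing hψ).continuous.tendsto f).comp (tendsto_toLp hu h)
  rw [pairing_apply] at this
  refine this.congr fun n => ?_
  rw [Function.comp_apply, pairing_apply, integral_toLp_mul]

end Limits

instance : IsFiniteMeasure diskMeasure :=
  ⟨by rw [Measure.restrict_apply_univ]; exact measure_ball_lt_top⟩

theorem memLp_disk {ψ : ℂ → ℂ} (hψ : Continuous ψ) : MemLp ψ 2 diskMeasure := by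
  obtain ⟨C, hC⟩ := (isCompact_closedBall (0 : ℂ) 1).exists_bound_of_continuousOn hψ.continuousOn
  refine MemLp.of_bound hψ.aestronglyMeasurable C ?_
  filter_upwards [ae_restrict_mem measurableSet_ball] with z hz
  exact hC z (Metric.ball_subset_closedBall hz)

theorem memLp_bdry {ψ : BdryCircle → ℂ} (hψ : Continuous ψ) : MemLp ψ 2 bdryMeasure := by
  obtain ⟨C, hC⟩ := isCompact_univ.exists_bound_of_continuousOn hψ.continuousOn
  exact MemLp.of_bound hψ.aestronglyMeasurable C (Eventually.of_forall fun z => hC z trivial)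

theorem memLp_disk_fderiv {u : ℂ → ℂ} (hu : ContDiff ℝ ∞ u) (v : ℂ) :
    MemLp (fun z => fderiv ℝ u z v) 2 diskMeasure :=
  memLp_disk ((hu.continuous_fderiv (by simp)).clm_apply continuous_const)

theorem memLp_bdry_comp {u : ℂ → ℂ} (hu : Continuous u) :
    MemLp (fun β => u (bdryPoint β)) 2 bdryMeasure :=
  memLp_bdry (hu.comp continuous_bdryPoint)

theorem L2Disk.integral_sub_mul (f g : L2Disk) {ψ : ℂ → ℂ} (h : MemLp ψ 2 diskMeasure) :
    ∫ z, (f - g : L2Disk) z * ψ z ∂diskMeasure =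
      ∫ z, f z * ψ z ∂diskMeasure - ∫ z, g z * ψ z ∂diskMeasure := by
  rw [← pairing_apply h, ← pairing_apply h, ← pairing_apply h, map_sub]

/-- The fundamental lemma of the calculus of variations on the disk. -/
theorem L2Disk.eq_zero_of_integral_test {f : L2Disk}
    (h : ∀ φ, IsTest φ → ∫ z, f z * φ z ∂diskMeasure = 0) : f = 0 := by
  rw [Lp.eq_zero_iff_ae_eq_zero]
  have hint : IntegrableOn f disk volume := (Lp.memLp f).integrable (by simp)
  have hloc := hint.locallyIntegrableOn
  have := IsOpen.ae_eq_zero_of_integral_contDiff_smul_eq_zero Metric.isOpen_ball hloc (by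
    intro g hg hc hs
    have hφ : IsTest fun z => (g z : ℂ) :=
      ⟨Complex.ofRealCLM.contDiff.comp hg, hc.comp_left (g := ((↑) : ℝ → ℂ)) (by simp),
        (tsupport_comp_subset Complex.ofReal_zero g).trans hs⟩
    rw [← h _ hφ, ← setIntegral_eq_integral_of_forall_compl_eq_zero (s := disk)]
    · simp only [Complex.real_smul, mul_comm]
    · intro z hz
      rw [image_eq_zero_of_notMem_tsupport fun hh => hz (hs hh), zero_smul])
  exact (ae_restrict_iff' measurableSet_ball).mpr this

/-- Allows the derivatives hidden in `IsTrace` to be identified with any given ones. -/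
theorem HasWeakDeriv.unique {v : ℂ} {f g g' : L2Disk} (h : HasWeakDeriv v f g)
    (h' : HasWeakDeriv v f g') : g = g' := by
  rw [← sub_eq_zero]
  refine L2Disk.eq_zero_of_integral_test fun φ hφ => ?_
  rw [L2Disk.integral_sub_mul _ _ hφ.memLp, sub_eq_zero, ← neg_inj, ← h φ hφ, ← h' φ hφ]

theorem bdryPoint_mem_sphere (β : BdryCircle) : ‖bdryPoint β‖ = 1 := Circle.norm_coe _

theorem IsTest.bdry {φ : ℂ → ℂ} (hφ : IsTest φ) (β : BdryCircle) : φ (bdryPoint β) = 0 := by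
  refine image_eq_zero_of_notMem_tsupport fun h => ?_
  have := hφ.support h
  rw [mem_ball_zero_iff, bdryPoint_mem_sphere] at this
  exact lt_irrefl _ this

/-! ### Integration by parts, for smooth functions and for functions with a trace -/

theorem fderiv_mul_apply {u ψ : ℂ → ℂ} (hu : ContDiff ℝ ∞ u) (hψ : ContDiff ℝ ∞ ψ) (z v : ℂ) :
    fderiv ℝ (fun z => u z * ψ z) z v = fderiv ℝ u z v * ψ z + u z * fderiv ℝ ψ z v := by
  rw [fderiv_fun_mul (hu.differentiable (by simp) z) (hψ.differentiable (by simp) z)]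
  simp; ring

/-- Integration by parts for smooth functions on the disk. -/
theorem integral_disk_by_parts (κ : ℂ) {u ψ : ℂ → ℂ} (hu : ContDiff ℝ ∞ u)
    (hψ : ContDiff ℝ ∞ ψ) :
    ∫ z, fderiv ℝ u z 1 * ψ z ∂diskMeasure + κ * ∫ z, fderiv ℝ u z Complex.I * ψ z ∂diskMeasure +
      ∫ z, u z * (fderiv ℝ ψ z 1 + κ * fderiv ℝ ψ z Complex.I) ∂diskMeasure =
      2 * Real.pi * ∫ β, u (bdryPoint β) *
        (((bdryPoint β).re + κ * (bdryPoint β).im) * ψ (bdryPoint β)) ∂bdryMeasure := by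
  have hI : ∀ {a b : ℂ → ℂ}, MemLp a 2 diskMeasure → MemLp b 2 diskMeasure →
    Integrable (fun z => a z * b z) diskMeasure := fun ha hb => ha.integrable_mul hb
  have hψ2 := memLp_disk hψ.continuous
  have hu2 := memLp_disk hu.continuous
  have h := integral_disk_deriv_bdry κ (hu.mul hψ)
  rw [← integral_const_mul, ← integral_add, ← integral_add]
  · convert h using 2
    · ext z
      simp only [fderiv_mul_apply hu hψ]
      ring
    · refine integral_congr_ae (Eventually.of_forall fun β => ?_)
      ring
  · exact (hI (memLp_disk_fderiv hu 1) hψ2).add ((hI (memLp_disk_fderiv hu _) hψ2).const_mul κ)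
  · exact hI hu2 ((memLp_disk_fderiv hψ 1).add ((memLp_disk_fderiv hψ _).const_mul κ))
  · exact hI (memLp_disk_fderiv hu 1) hψ2
  · exact (hI (memLp_disk_fderiv hu _) hψ2).const_mul κ

theorem integral_fderiv_mul_test {u φ : ℂ → ℂ} (hu : ContDiff ℝ ∞ u) (hφ : IsTest φ) :
    (∫ z, u z * fderiv ℝ φ z 1 ∂diskMeasure = -∫ z, fderiv ℝ u z 1 * φ z ∂diskMeasure) ∧
    ∫ z, u z * fderiv ℝ φ z Complex.I ∂diskMeasure =
      -∫ z, fderiv ℝ u z Complex.I * φ z ∂diskMeasure := by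
  -- Test functions vanish on the circle, so there is no boundary term. The choice κ = 0 gives ∂_x,
  -- and subtracting it from κ = 1 gives ∂_y.
  have h0 := integral_disk_by_parts 0 hu hφ.smooth
  have h1 := integral_disk_by_parts 1 hu hφ.smooth
  simp only [hφ.bdry, mul_zero, integral_zero, zero_mul, add_zero, one_mul, mul_add] at h0 h1
  have hadd : ∫ z, (u z * fderiv ℝ φ z 1 + u z * fderiv ℝ φ z Complex.I) ∂diskMeasure =
      ∫ z, u z * fderiv ℝ φ z 1 ∂diskMeasure + ∫ z, u z * fderiv ℝ φ z Complex.I ∂diskMeasure :=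
    integral_add ((memLp_disk hu.continuous).integrable_mul (hφ.memLp_fderiv 1))
      ((memLp_disk hu.continuous).integrable_mul (hφ.memLp_fderiv Complex.I))
  rw [hadd] at h1
  constructor
  · linear_combination h0
  · linear_combination h1 - h0

theorem hasWeakDeriv_of_tendsto {u : ℕ → ℂ → ℂ} (hus : ∀ n, ContDiff ℝ ∞ (u n)) {f fv : L2Disk}
    {v : ℂ} (hv : v = 1 ∨ v = Complex.I)
    (h0 : Tendsto (fun n => eLpNorm (fun z => u n z - f z) 2 diskMeasure) atTop (𝓝 0))
    (h1 : Tendsto (fun n => eLpNorm (fun z => fderiv ℝ (u n) z v - fv z) 2 diskMeasure)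
      atTop (𝓝 0)) : HasWeakDeriv v f fv := by
  intro φ hφ
  refine tendsto_nhds_unique
    (tendsto_integral_mul (fun n => memLp_disk (hus n).continuous) h0 (hφ.memLp_fderiv v)) ?_
  refine (tendsto_integral_mul (fun n => memLp_disk_fderiv (hus n) v) h1 hφ.memLp).neg.congr
    fun n => ?_
  rcases hv with rfl | rfl
  · exact (integral_fderiv_mul_test (hus n) hφ).1.symm
  · exact (integral_fderiv_mul_test (hus n) hφ).2.symm

theorem IsTrace.mem_H1 {f : L2Disk} {t : L2Bdry} (h : IsTrace f t) : f ∈ H1 := by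
  obtain ⟨u, -, ⟨-, fx, fy, hx, hy, -⟩, -⟩ := h
  exact ⟨fx, fy, hx, hy⟩

/-- Green's formula for `H¹` functions with a trace. -/
theorem IsTrace.integral_by_parts {f fx fy : L2Disk} {t : L2Bdry} (h : IsTrace f t)
    (hx : HasWeakDeriv 1 f fx) (hy : HasWeakDeriv Complex.I f fy) (κ : ℂ) {ψ : ℂ → ℂ}
    (hψ : ContDiff ℝ ∞ ψ) :
    ∫ z, fx z * ψ z ∂diskMeasure + κ * ∫ z, fy z * ψ z ∂diskMeasure +
      ∫ z, f z * (fderiv ℝ ψ z 1 + κ * fderiv ℝ ψ z Complex.I) ∂diskMeasure =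
      2 * Real.pi * ∫ β, t β *
        (((bdryPoint β).re + κ * (bdryPoint β).im) * ψ (bdryPoint β)) ∂bdryMeasure := by
  obtain ⟨u, hus, ⟨h0, fx', fy', hx', hy', h1, h2⟩, hb⟩ := h
  obtain rfl := hx.unique hx'
  obtain rfl := hy.unique hy'
  have hψ2 := memLp_disk hψ.continuous
  have L := ((tendsto_integral_mul (fun n => memLp_disk_fderiv (hus n) 1) h1 hψ2).add
    ((tendsto_integral_mul (fun n => memLp_disk_fderiv (hus n) _) h2 hψ2).const_mul κ)).add
    (tendsto_integral_mul (fun n => memLp_disk (hus n).continuous) h0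
      ((memLp_disk_fderiv hψ 1).add ((memLp_disk_fderiv hψ Complex.I).const_mul κ)))
  have hc : Continuous fun β : BdryCircle =>
      ((bdryPoint β).re + κ * (bdryPoint β).im) * ψ (bdryPoint β) := by
    have := continuous_bdryPoint
    have := hψ.continuous
    fun_prop
  have R := (tendsto_integral_mul (fun n => memLp_bdry_comp (hus n).continuous) hb
    (memLp_bdry hc)).const_mul (2 * Real.pi : ℂ)
  refine tendsto_nhds_unique L (R.congr fun n => ?_)
  exact (integral_disk_by_parts κ (hus n) hψ).symm

/-! ### Monomials and the Fourier coefficients of a trace -/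

/-- `IsSign c σ` says that `c` is the identity and `σ = 1`, or that `c` is the complex conjugation
and `σ = -1`, so that `c (e^{iβ}) = e^{iσβ}`. -/
def IsSign (c : ℂ →ₐ[ℝ] ℂ) (σ : ℤ) : Prop :=
  c = AlgHom.id ℝ ℂ ∧ σ = 1 ∨ c = Complex.conjAe.toAlgHom ∧ σ = -1

/-- The conjugate of `c`. -/
def bar (c : ℂ →ₐ[ℝ] ℂ) : ℂ →ₐ[ℝ] ℂ := Complex.conjAe.toAlgHom.comp c

theorem bar_apply (c : ℂ →ₐ[ℝ] ℂ) (z : ℂ) : bar c z = starRingEnd ℂ (c z) := rfl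

theorem isSign_id : IsSign (AlgHom.id ℝ ℂ) 1 := Or.inl ⟨rfl, rfl⟩

theorem isSign_conj : IsSign Complex.conjAe.toAlgHom (-1) := Or.inr ⟨rfl, rfl⟩

variable {c : ℂ →ₐ[ℝ] ℂ} {σ : ℤ}

theorem IsSign.bar (h : IsSign c σ) : IsSign (bar c) (-σ) := by
  rcases h with ⟨rfl, rfl⟩ | ⟨rfl, rfl⟩
  · exact Or.inr ⟨rfl, rfl⟩
  · refine Or.inl ⟨?_, by simp⟩
    ext
    simp [bar_apply]

theorem IsSign.norm (h : IsSign c σ) (z : ℂ) : ‖c z‖ = ‖z‖ := by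
  rcases h with ⟨rfl, rfl⟩ | ⟨rfl, rfl⟩ <;> simp

theorem IsSign.mul_self (h : IsSign c σ) : σ * σ = 1 := by
  rcases h with ⟨rfl, rfl⟩ | ⟨rfl, rfl⟩ <;> simp

theorem IsSign.bdry (h : IsSign c σ) (β : BdryCircle) : c (bdryPoint β) = fourier σ β := by
  rcases h with ⟨rfl, rfl⟩ | ⟨rfl, rfl⟩
  · simp
  · rw [fourier_neg, fourier_one]; simp

theorem algHom_apply (c : ℂ →ₐ[ℝ] ℂ) (z : ℂ) : c z = z.re + c Complex.I * z.im := by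
  have h := fderiv_apply_eq (LinearMap.toContinuousLinearMap c.toLinearMap) z
  simp only [LinearMap.coe_toContinuousLinearMap', AlgHom.toLinearMap_apply, map_one, mul_one] at h
  rw [h, mul_comm (c Complex.I)]

theorem algHom_I_sq (c : ℂ →ₐ[ℝ] ℂ) : c Complex.I * c Complex.I = -1 := by
  rw [← map_mul, Complex.I_mul_I, map_neg, map_one]

theorem IsSign.I_mul_conj (h : IsSign c σ) : c Complex.I * starRingEnd ℂ (c Complex.I) = 1 := by
  rw [Complex.mul_conj, Complex.normSq_eq_norm_sq, h.norm]; simp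

theorem hasFDerivAt_algHom (c : ℂ →ₐ[ℝ] ℂ) (z : ℂ) :
    HasFDerivAt c (LinearMap.toContinuousLinearMap c.toLinearMap) z :=
  (LinearMap.toContinuousLinearMap c.toLinearMap).hasFDerivAt

theorem contDiff_algHom (c : ℂ →ₐ[ℝ] ℂ) : ContDiff ℝ ∞ c :=
  (LinearMap.toContinuousLinearMap c.toLinearMap).contDiff

/-- The monomial `(c z)^a * conj (c z)^b`. -/
def mono (c : ℂ →ₐ[ℝ] ℂ) (a b : ℕ) (z : ℂ) : ℂ := c z ^ a * bar c z ^ b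

theorem contDiff_mono (c : ℂ →ₐ[ℝ] ℂ) (a b : ℕ) : ContDiff ℝ ∞ (mono c a b) :=
  ((contDiff_algHom c).pow a).mul ((contDiff_algHom (bar c)).pow b)

/-- The truncated exponents a - 1 and b - 1 are harmless at zero, being multiplied by a or b. -/
theorem fderiv_mono (c : ℂ →ₐ[ℝ] ℂ) (a b : ℕ) (z v : ℂ) :
    fderiv ℝ (mono c a b) z v =
      a * mono c (a - 1) b z * c v + b * mono c a (b - 1) z * bar c v := by
  have h := ((hasFDerivAt_algHom c z).pow a).mul ((hasFDerivAt_algHom (bar c) z).pow b)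
  have h' : HasFDerivAt (mono c a b) _ z := h
  rw [h'.fderiv]
  simp [mono]
  ring

/-- The operator ∂_x + c(i)∂_y kills c z because 1 + c(i)² = 0, and sends its conjugate to 2 because
c(i) has modulus one; the product rule does the rest. -/
theorem IsSign.deriv_mono (h : IsSign c σ) (a b : ℕ) (z : ℂ) :
    fderiv ℝ (mono c a b) z 1 + c Complex.I * fderiv ℝ (mono c a b) z Complex.I =
      2 * b * mono c a (b - 1) z := by
  rw [fderiv_mono, fderiv_mono, map_one, map_one]
  have h1 := algHom_I_sq c
  have h2 : c Complex.I * DiskSobolev.bar c Complex.I = 1 := h.I_mul_conj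
  linear_combination (a * mono c (a - 1) b z) * h1 + (b * mono c a (b - 1) z) * h2

theorem fourier_pow {n : ℤ} (k : ℕ) (β : BdryCircle) : fourier n β ^ k = fourier (n * k) β := by
  induction k with
  | zero => simp
  | succ k ih => rw [pow_succ, ih, ← fourier_add]; congr 2; push_cast; ring

theorem IsSign.mono_bdry (h : IsSign c σ) (a b : ℕ) (β : BdryCircle) :
    mono c a b (bdryPoint β) = fourier (σ * (a - b)) β := by
  rw [mono, h.bdry, h.bar.bdry, fourier_pow, fourier_pow, ← fourier_add]
  congr 2; ring

/-- The Fourier coefficients of the trace in terms of the function and its derivatives. -/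
theorem IsTrace.fourierCoeff_eq {f fx fy : L2Disk} {t : L2Bdry} (h : IsTrace f t)
    (hx : HasWeakDeriv 1 f fx) (hy : HasWeakDeriv Complex.I f fy) (hc : IsSign c σ) (a b : ℕ) :
    ∫ z, (fx + c Complex.I • fy : L2Disk) z * mono c a b z ∂diskMeasure +
      2 * b * ∫ z, f z * mono c a (b - 1) z ∂diskMeasure =
      2 * Real.pi * fourierCoeff t (-(σ * (1 + a - b))) := by
  have key := h.integral_by_parts hx hy (c Complex.I) (contDiff_mono c a b)
  rw [integral_add_mul _ _ (memLp_disk (contDiff_mono c a b).continuous), integral_smul_mul,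
    ← integral_const_mul (2 * b : ℂ)]
  convert key using 2
  · congr 1
    ext z
    rw [hc.deriv_mono]; ring
  · refine integral_congr_ae (Eventually.of_forall fun β => ?_)
    simp only
    -- On the circle the Green weight is c(e^{iβ}) = e^{iσβ}, which raises the frequency σ(a - b) of
    -- the monomial by σ.
    rw [← algHom_apply, hc.mono_bdry, hc.bdry, ← fourier_add, smul_eq_mul, mul_comm, neg_neg,
      show σ * (1 + (a : ℤ) - b) = σ + σ * (a - b) by ring]

/-! ### Uniqueness of the trace -/

theorem fourierCoeff_ext {s t : L2Bdry} (h : ∀ n, fourierCoeff s n = fourierCoeff t n) :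
    s = t := by
  apply fourierBasis.repr.injective
  ext n
  rw [fourierBasis_repr, fourierBasis_repr, h]

theorem fourierCoeff_Lp_add (s t : L2Bdry) (n : ℤ) :
    fourierCoeff (s + t : L2Bdry) n = fourierCoeff s n + fourierCoeff t n := by
  simp only [← fourierBasis_repr, map_add]; rfl

theorem fourierCoeff_Lp_zero (n : ℤ) : fourierCoeff (0 : L2Bdry) n = 0 := by
  simp only [← fourierBasis_repr, map_zero]; rfl

theorem fourierCoeff_at_zero (t : L2Bdry) : fourierCoeff t 0 = ∫ β, t β ∂bdryMeasure := by
  simp [fourierCoeff]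

theorem IsTrace.sub {f g : L2Disk} {s t : L2Bdry} (hf : IsTrace f s) (hg : IsTrace g t) :
    IsTrace (f - g) (s - t) := by
  simpa [sub_eq_add_neg] using hf.add (hg.smul (-1))

/-- With f and its derivatives zero, `IsTrace.fourierCoeff_eq` makes every coefficient vanish, since
1 + a - b runs over all integers. -/
theorem IsTrace.eq_zero {t : L2Bdry} (h : IsTrace 0 t) : t = 0 := by
  refine fourierCoeff_ext fun n => ?_
  rw [fourierCoeff_Lp_zero]
  have key := fun a b => h.fourierCoeff_eq (HasWeakDeriv.zero _) (HasWeakDeriv.zero _) isSign_id a b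
  have h0 : ∀ ψ : ℂ → ℂ, ∫ z, (0 : L2Disk) z * ψ z ∂diskMeasure = 0 := fun ψ => by
    simpa using integral_smul_mul 0 (0 : L2Disk) ψ
  simp only [smul_zero, add_zero, h0, mul_zero] at key
  have h2 : ∃ a b : ℕ, -(1 * (1 + (a : ℤ) - b)) = n := by
    rcases le_or_gt 0 n with hn | hn
    · exact ⟨0, (n + 1).toNat, by push_cast; omega⟩
    · exact ⟨(-n - 1).toNat, 0, by push_cast; omega⟩
  obtain ⟨a, b, rfl⟩ := h2
  simpa [Real.pi_ne_zero] using (key a b).symm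

theorem IsTrace.unique {f : L2Disk} {s t : L2Bdry} (hs : IsTrace f s) (ht : IsTrace f t) :
    s = t := by
  rw [← sub_eq_zero]
  refine IsTrace.eq_zero (?_ : IsTrace 0 (s - t))
  simpa using hs.sub ht

/-! ### Orthogonality of powers and decay of the Fourier coefficients -/

theorem integral_fourier (n : ℤ) :
    ∫ β, fourier n β ∂bdryMeasure = if n = 0 then 1 else 0 := by
  have h := fourierCoeff_fourier (T := 2 * Real.pi) n
  have := congrFun h 0
  simp only [fourierCoeff, neg_zero, fourier_zero, one_smul] at this
  rw [this, Pi.single_apply]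
  simp [eq_comm]

/-- Since `mono c a (b + 1)` has derivative 2(b + 1) times the integrand, Green's formula reduces
the area integral to the mean of e^{iσ(a - b)β} over the circle. -/
theorem IsSign.integral_mono (hc : IsSign c σ) (a b : ℕ) :
    ∫ z, mono c a b z ∂diskMeasure = if a = b then (Real.pi / (b + 1) : ℂ) else 0 := by
  have h := integral_disk_deriv_bdry (c Complex.I) (contDiff_mono c a (b + 1))
  simp only [hc.deriv_mono, ← algHom_apply, hc.mono_bdry, hc.bdry, ← fourier_add,
    integral_fourier, integral_const_mul, Nat.add_sub_cancel] at h
  have hσ := hc.mul_self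
  have h1 : (σ + σ * ((a : ℤ) - ((b + 1 : ℕ) : ℤ)) = 0) ↔ a = b := by
    have : σ ≠ 0 := by rintro rfl; simp at hσ
    rw [show σ + σ * ((a : ℤ) - ((b + 1 : ℕ) : ℤ)) = σ * (a - b) by push_cast; ring,
      mul_eq_zero, or_iff_right this, sub_eq_zero, Nat.cast_inj]
  simp only [h1] at h
  have hb : (b + 1 : ℂ) ≠ 0 := by exact_mod_cast Nat.succ_ne_zero b
  push_cast at h
  split_ifs at h ⊢
  · field_simp
    linear_combination h / 2
  · simpa [hb] using h

/-- The function `(c z)^k` as an element of `L²(M)`. -/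
def zpow (c : ℂ →ₐ[ℝ] ℂ) (k : ℕ) : L2Disk :=
  (memLp_disk ((contDiff_algHom c).continuous.pow k)).toLp (fun z => c z ^ k)

theorem coeFn_zpow (c : ℂ →ₐ[ℝ] ℂ) (k : ℕ) : zpow c k =ᵐ[diskMeasure] fun z => c z ^ k :=
  MemLp.coeFn_toLp _

theorem inner_zpow_left (c : ℂ →ₐ[ℝ] ℂ) (k : ℕ) (f : L2Disk) :
    inner ℂ (zpow c k) f = ∫ z, f z * bar c z ^ k ∂diskMeasure := by
  rw [L2.inner_def]
  refine integral_congr_ae ?_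
  filter_upwards [coeFn_zpow c k] with z hz
  rw [hz, RCLike.inner_apply, map_pow, bar_apply]

theorem IsSign.inner_zpow (hc : IsSign c σ) (j k : ℕ) :
    inner ℂ (zpow c j) (zpow c k) = if j = k then (Real.pi / (k + 1) : ℂ) else 0 := by
  rw [inner_zpow_left]
  have := hc.integral_mono k j
  rw [show (if j = k then (Real.pi / (k + 1) : ℂ) else 0) =
    if k = j then (Real.pi / (j + 1) : ℂ) else 0 by
      by_cases h : j = k
      · rw [h]
      · rw [if_neg h, if_neg (Ne.symm h)], ← this]
  refine integral_congr_ae ?_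
  filter_upwards [coeFn_zpow c k] with z hz
  rw [hz, mono]

/-- The normalized powers. -/
def unitPow (c : ℂ →ₐ[ℝ] ℂ) (k : ℕ) : L2Disk :=
  ((√((k + 1) / Real.pi) : ℝ) : ℂ) • zpow c k

theorem IsSign.orthonormal (hc : IsSign c σ) : Orthonormal ℂ (unitPow c) := by
  rw [orthonormal_iff_ite]
  intro j k
  rw [unitPow, unitPow, inner_smul_left, inner_smul_right, hc.inner_zpow]
  split_ifs with h
  · subst h
    rw [Complex.conj_ofReal, ← mul_assoc, ← Complex.ofReal_mul, Real.mul_self_sqrt (by positivity)]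
    have : (j + 1 : ℂ) ≠ 0 := by exact_mod_cast Nat.succ_ne_zero j
    have : (Real.pi : ℂ) ≠ 0 := by exact_mod_cast Real.pi_ne_zero
    push_cast
    field_simp
  · simp

theorem summable_smul_of_orthonormal {E : Type*} [NormedAddCommGroup E] [InnerProductSpace ℂ E]
    [CompleteSpace E] {e : ℕ → E} (he : Orthonormal ℂ e) {b : ℕ → ℂ}
    (hb : Summable fun k => ‖b k‖ ^ 2) : Summable fun k => b k • e k := by
  have h := he.orthogonalFamily.summable_iff_norm_sq_summable b
  simpa using h.mpr hb

/-- The powers are orthogonal with ‖z^m‖² = π/(m + 1), so square summability with the weight 1/(m +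
1) suffices. -/
theorem IsSign.summable_smul_zpow (hc : IsSign c σ) {g : ℕ → ℕ} (hg : g.Injective) {b : ℕ → ℂ}
    (hb : Summable fun k => ‖b k‖ ^ 2 / (g k + 1)) :
    Summable fun k => b k • zpow c (g k) := by
  have he := hc.orthonormal.comp g hg
  have hpos : ∀ k : ℕ, (0 : ℝ) < √((k + 1) / Real.pi) := fun k => by positivity
  have h := summable_smul_of_orthonormal he
    (b := fun k => b k * ((√((g k + 1) / Real.pi) : ℝ) : ℂ)⁻¹) (by
      refine (hb.mul_left Real.pi).congr fun k => ?_
      rw [norm_mul, norm_inv, Complex.norm_real, Real.norm_of_nonneg (hpos _).le, mul_pow, inv_pow,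
        Real.sq_sqrt (by positivity)]
      field_simp)
  refine h.congr fun k => ?_
  have : ((√((g k + 1) / Real.pi) : ℝ) : ℂ) ≠ 0 := by exact_mod_cast (hpos (g k)).ne'
  rw [Function.comp_apply, unitPow, smul_smul, mul_assoc, inv_mul_cancel₀ this, mul_one]

/-- The Fourier coefficients of a trace have the decay of `H^{1/2}`. -/
theorem IsTrace.summable {f : L2Disk} {t : L2Bdry} (h : IsTrace f t) (hc : IsSign c σ) :
    Summable fun k : ℕ => ‖fourierCoeff t (σ * (k + 1))‖ ^ 2 * (k + 1) := by
  obtain ⟨fx, fy, hx, hy⟩ := h.mem_H1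
  -- Bessel's inequality. Pairing with (c z)^k integrates against its conjugate, so Green's formula
  -- is used for the conjugate of c and yields the frequency σ(k + 1). The squared inner product is
  -- (k + 1)/π · |2π t̂|², whence the factor 1/(4π).
  have hb := hc.orthonormal.inner_products_summable (x := fx + bar c Complex.I • fy)
  refine (hb.mul_left (1 / (4 * Real.pi))).congr fun k => ?_
  have key := h.fourierCoeff_eq hx hy hc.bar k 0
  simp only [Nat.cast_zero, mul_zero, zero_mul, add_zero, sub_zero, mono, pow_zero, mul_one]
    at key
  rw [unitPow, inner_smul_left, inner_zpow_left, key, norm_mul, norm_mul, Complex.conj_ofReal,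
    Complex.norm_real, Real.norm_of_nonneg (by positivity), mul_pow, mul_pow,
    Real.sq_sqrt (by positivity), show -(-σ * (1 + (k : ℤ))) = σ * (k + 1) by ring]
  have : ‖(2 * Real.pi : ℂ)‖ = 2 * Real.pi := by
    simp [abs_of_pos Real.pi_pos]
  rw [this]
  field_simp
  ring

/-! ### The distributional kernels -/

/-- The space of distributional solutions of `(∂_x + c(i) ∂_y) f = 0`. -/
def dKer (c : ℂ →ₐ[ℝ] ℂ) : Submodule ℂ L2Disk where
  carrier := {f | ∀ φ : ℂ → ℂ, IsTest φ →
    ∫ z, f z * (fderiv ℝ φ z 1 + c Complex.I * fderiv ℝ φ z Complex.I) ∂diskMeasure = 0}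
  zero_mem' := fun φ _ => by
    simpa using integral_smul_mul 0 (0 : L2Disk)
      (fun z => fderiv ℝ φ z 1 + c Complex.I * fderiv ℝ φ z Complex.I)
  add_mem' := by
    intro f g hf hg φ hφ
    have h := (hφ.memLp_fderiv 1).add ((hφ.memLp_fderiv Complex.I).const_mul (c Complex.I))
    exact (integral_add_mul f g h).trans
      (by rw [← add_zero 0]; exact congr_arg₂ _ (hf φ hφ) (hg φ hφ))
  smul_mem' := by
    intro a f hf φ hφ
    rw [integral_smul_mul, hf φ hφ, mul_zero]

theorem dKer_conj : dKer Complex.conjAe.toAlgHom = ker0EtaPlus := by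
  ext f
  refine forall₂_congr fun φ _ => ?_
  have : ∫ z, f z * wirtinger φ z ∂diskMeasure =
      1 / 2 * ∫ z, f z * (fderiv ℝ φ z 1 + Complex.conjAe.toAlgHom Complex.I *
        fderiv ℝ φ z Complex.I) ∂diskMeasure := by
    rw [← integral_const_mul]
    congr 1
    ext z
    simp [wirtinger]
    ring
  rw [this]
  simp

theorem dKer_id : dKer (AlgHom.id ℝ ℂ) = ker0EtaMinus := by
  ext f
  refine forall₂_congr fun φ _ => ?_
  have : ∫ z, f z * wirtingerBar φ z ∂diskMeasure =
      1 / 2 * ∫ z, f z * (fderiv ℝ φ z 1 + AlgHom.id ℝ ℂ Complex.I *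
        fderiv ℝ φ z Complex.I) ∂diskMeasure := by
    rw [← integral_const_mul]
    congr 1
    ext z
    simp [wirtingerBar]
    ring
  rw [this]
  simp

theorem integral_mul_dTest {f fx fy : L2Disk} (hx : HasWeakDeriv 1 f fx)
    (hy : HasWeakDeriv Complex.I f fy) (c : ℂ →ₐ[ℝ] ℂ) {φ : ℂ → ℂ} (hφ : IsTest φ) :
    ∫ z, f z * (fderiv ℝ φ z 1 + c Complex.I * fderiv ℝ φ z Complex.I) ∂diskMeasure =
      -∫ z, (fx + c Complex.I • fy : L2Disk) z * φ z ∂diskMeasure := by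
  rw [integral_add_mul _ _ hφ.memLp, integral_smul_mul, neg_add, ← mul_neg, ← hx φ hφ, ← hy φ hφ,
    ← integral_const_mul, ← integral_add]
  · congr 1
    ext z
    ring
  · exact integrable_mul_test f (hφ.memLp_fderiv 1)
  · exact (integrable_mul_test f (hφ.memLp_fderiv _)).const_mul _

theorem mem_dKer_iff {f fx fy : L2Disk} (hx : HasWeakDeriv 1 f fx)
    (hy : HasWeakDeriv Complex.I f fy) : f ∈ dKer c ↔ fx + c Complex.I • fy = 0 := by
  constructor
  · intro h
    refine L2Disk.eq_zero_of_integral_test fun φ hφ => ?_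
    rw [← neg_eq_zero, ← integral_mul_dTest hx hy c hφ]
    exact h φ hφ
  · intro h φ hφ
    rw [integral_mul_dTest hx hy c hφ, h]
    simpa using integral_smul_mul 0 (0 : L2Disk) φ

/-- The trace of an element of the kernel only has nonnegative frequencies. -/
theorem IsTrace.fourierCoeff_eq_zero {f : L2Disk} {t : L2Bdry} (h : IsTrace f t)
    (hf : f ∈ dKer c) (hc : IsSign c σ) (k : ℕ) : fourierCoeff t (-(σ * (k + 1))) = 0 := by
  obtain ⟨fx, fy, hx, hy⟩ := h.mem_H1
  -- Both interior terms vanish: the first because f is in the kernel, the second because b = 0.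
  have key := h.fourierCoeff_eq hx hy hc k 0
  rw [(mem_dKer_iff hx hy).mp hf] at key
  have h0 : ∫ z, (0 : L2Disk) z * mono c k 0 z ∂diskMeasure = 0 := by
    simpa using integral_smul_mul 0 (0 : L2Disk) (mono c k 0)
  rw [h0] at key
  simp only [Nat.cast_zero, mul_zero, zero_mul, add_zero, sub_zero] at key
  rw [add_comm (k : ℤ)]
  simpa [Real.pi_ne_zero] using key.symm

/-! ### Density of polynomials and uniqueness in the kernel -/

/-- Polynomials in `z` and `conj z` are dense in the continuous functions on the closed disk. -/
theorem exists_mono_span_near {φ : ℂ → ℂ} (hφ : Continuous φ) {ε : ℝ} (hε : 0 < ε) :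
    ∃ P ∈ Submodule.span ℂ (Set.range fun p : ℕ × ℕ => mono (AlgHom.id ℝ ℂ) p.1 p.2),
      Continuous P ∧ ∀ z ∈ Metric.closedBall (0 : ℂ) 1, ‖φ z - P z‖ < ε := by
  set s := Metric.closedBall (0 : ℂ) 1
  have : CompactSpace s := isCompact_iff_compactSpace.mp (isCompact_closedBall 0 1)
  set X : C(s, ℂ) := ContinuousMap.restrict s (.id ℂ)
  -- Stone–Weierstrass: the star algebra generated by the coordinate is dense. Algebraically it is
  -- the span of the products X^a X̄^b.
  have htop : StarAlgebra.elemental ℂ X = ⊤ := ContinuousMap.elemental_id_eq_top s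
  have hmem : (⟨fun z : s => φ z, hφ.comp continuous_subtype_val⟩ : C(s, ℂ)) ∈
      closure ((StarAlgebra.adjoin ℂ {X} : StarSubalgebra ℂ C(s, ℂ)) : Set C(s, ℂ)) := by
    have : (⟨fun z : s => φ z, hφ.comp continuous_subtype_val⟩ : C(s, ℂ)) ∈
      StarAlgebra.elemental ℂ X := htop ▸ trivial
    exact this
  obtain ⟨p, hp, hdist⟩ := Metric.mem_closure_iff.mp hmem ε hε
  have hp' : p ∈ Submodule.span ℂ (Set.range fun p : ℕ × ℕ => X ^ p.1 * star X ^ p.2) := by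
    have h1 : p ∈ Algebra.adjoin ℂ ({X} ∪ star {X}) := by
      rw [← StarAlgebra.adjoin_toSubalgebra]; exact hp
    rw [← Subalgebra.mem_toSubmodule, Algebra.adjoin_eq_span] at h1
    refine Submodule.span_mono ?_ h1
    intro q hq
    rw [Set.star_singleton, Set.singleton_union, SetLike.mem_coe,
      Submonoid.mem_closure_pair] at hq
    obtain ⟨a, b, rfl⟩ := hq
    exact ⟨(a, b), rfl⟩
  -- Lifting the span through the restriction map makes the approximant a polynomial on the whole
  -- plane.
  set R : C(ℂ, ℂ) →ₗ[ℂ] C(s, ℂ) :=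
    { toFun := fun f => f.restrict s, map_add' := fun _ _ => rfl, map_smul' := fun _ _ => rfl }
  set Y : ℕ × ℕ → C(ℂ, ℂ) := fun p =>
    ⟨mono (AlgHom.id ℝ ℂ) p.1 p.2, (contDiff_mono _ _ _).continuous⟩
  have hR : (Set.range fun p : ℕ × ℕ => X ^ p.1 * star X ^ p.2) = R '' Set.range Y := by
    rw [← Set.range_comp]
    rfl
  rw [hR, ← Submodule.map_span] at hp'
  obtain ⟨Q, hQ, rfl⟩ := hp'
  refine ⟨Q, ?_, Q.continuous, fun z hz => ?_⟩
  · have := Submodule.mem_map_of_mem (f := ContinuousMap.coeFnLinearMap ℂ) hQ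
    rw [Submodule.map_span, ← Set.range_comp] at this
    exact this
  · have := (ContinuousMap.dist_lt_iff hε).mp hdist ⟨z, hz⟩
    rwa [dist_eq_norm] at this

/-- Each test function is a uniform limit of polynomials on the closed disk, and f is integrable
there, so f integrates to zero against every test function. -/
theorem L2Disk.eq_zero_of_integral_mono {f : L2Disk}
    (h : ∀ a b, ∫ z, f z * mono (AlgHom.id ℝ ℂ) a b z ∂diskMeasure = 0) : f = 0 := by
  have hf : Integrable f diskMeasure := (Lp.memLp f).integrable (by simp)
  have hI : ∀ {P : ℂ → ℂ}, Continuous P → Integrable (fun z => f z * P z) diskMeasure :=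
    fun hP => integrable_mul_test f (memLp_disk hP)
  have hspan : ∀ P ∈ Submodule.span ℂ
      (Set.range fun p : ℕ × ℕ => mono (AlgHom.id ℝ ℂ) p.1 p.2),
      Continuous P ∧ ∫ z, f z * P z ∂diskMeasure = 0 := by
    intro P hP
    induction hP using Submodule.span_induction with
    | mem x hx =>
      obtain ⟨p, rfl⟩ := hx
      exact ⟨(contDiff_mono _ _ _).continuous, h _ _⟩
    | zero => exact ⟨continuous_const, by simp⟩
    | add x y _ _ hx hy =>
      refine ⟨hx.1.add hy.1, ?_⟩
      simp only [Pi.add_apply, mul_add]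
      rw [integral_add (hI hx.1) (hI hy.1), hx.2, hy.2, add_zero]
    | smul a x _ hx =>
      refine ⟨hx.1.const_smul a, ?_⟩
      simp only [Pi.smul_apply, smul_eq_mul, mul_left_comm _ a]
      rw [integral_const_mul, hx.2, mul_zero]
  refine L2Disk.eq_zero_of_integral_test fun φ hφ => ?_
  have hφc := hφ.smooth.continuous
  have hbound : ∀ ε > 0, ‖∫ z, f z * φ z ∂diskMeasure‖ ≤ ε * ∫ z, ‖f z‖ ∂diskMeasure := by
    intro ε hε
    obtain ⟨P, hP, hPc, hPε⟩ := exists_mono_span_near hφc hε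
    have : ∫ z, f z * φ z ∂diskMeasure = ∫ z, f z * (φ z - P z) ∂diskMeasure := by
      simp only [mul_sub]
      rw [integral_sub (hI hφc) (hI hPc), (hspan P hP).2, sub_zero]
    rw [this, ← integral_const_mul]
    refine norm_integral_le_of_norm_le (hf.norm.const_mul ε) ?_
    filter_upwards [ae_restrict_mem measurableSet_ball] with z hz
    rw [norm_mul, mul_comm]
    gcongr
    exact (hPε z (Metric.ball_subset_closedBall hz)).le
  rw [← norm_le_zero_iff]
  refine le_of_tendsto_of_tendsto (f := fun _ : ℝ => ‖∫ z, f z * φ z ∂diskMeasure‖)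
    (b := 𝓝[>] 0) tendsto_const_nhds ?_
    (Filter.eventually_of_mem self_mem_nhdsWithin hbound)
  have : Tendsto (fun ε : ℝ => ε * ∫ z, ‖f z‖ ∂diskMeasure) (𝓝 0) (𝓝 (0 * ∫ z, ‖f z‖ ∂diskMeasure)) :=
    tendsto_id.mul_const _
  rw [zero_mul] at this
  exact this.mono_left nhdsWithin_le_nhds

theorem IsSign.mono_eq (hc : IsSign c σ) (a b : ℕ) :
    mono (AlgHom.id ℝ ℂ) a b = mono c a b ∨ mono (AlgHom.id ℝ ℂ) a b = mono c b a := by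
  rcases hc with ⟨rfl, rfl⟩ | ⟨rfl, rfl⟩
  · exact Or.inl rfl
  · right
    ext z
    simp [mono, bar_apply, mul_comm]

/-- An element of the kernel with vanishing trace is zero. -/
theorem IsTrace.eq_zero_of_mem_dKer {f : L2Disk} (h : IsTrace f 0) (hf : f ∈ dKer c)
    (hc : IsSign c σ) : f = 0 := by
  obtain ⟨fx, fy, hx, hy⟩ := h.mem_H1
  have key : ∀ a b, ∫ z, f z * mono c a b z ∂diskMeasure = 0 := by
    intro a b
    -- The exponent b + 1 drops to b under the derivative, so every monomial is reached, with a
    -- nonzero factor 2(b + 1).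
    have key := h.fourierCoeff_eq hx hy hc a (b + 1)
    rw [(mem_dKer_iff hx hy).mp hf, fourierCoeff_Lp_zero] at key
    have h0 : ∫ z, (0 : L2Disk) z * mono c a (b + 1) z ∂diskMeasure = 0 := by
      simpa using integral_smul_mul 0 (0 : L2Disk) (mono c a (b + 1))
    rw [h0, zero_add, mul_zero, Nat.add_sub_cancel] at key
    have hb : (2 * ((b + 1 : ℕ) : ℂ)) ≠ 0 := by
      exact_mod_cast Nat.mul_ne_zero two_ne_zero (Nat.succ_ne_zero b)
    exact (mul_eq_zero.mp key).resolve_left hb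
  refine L2Disk.eq_zero_of_integral_mono fun a b => ?_
  rcases hc.mono_eq a b with h | h <;> rw [h] <;> exact key _ _

/-! ### Power series with prescribed trace -/

/-- The partial sums of a power series. -/
def partialSum (c : ℂ →ₐ[ℝ] ℂ) (a : ℕ → ℂ) (n : ℕ) (z : ℂ) : ℂ :=
  ∑ k ∈ Finset.range n, a k * c z ^ (k + 1)

theorem contDiff_partialSum (c : ℂ →ₐ[ℝ] ℂ) (a : ℕ → ℂ) (n : ℕ) :
    ContDiff ℝ ∞ (partialSum c a n) :=
  ContDiff.sum fun _ _ => contDiff_const.mul ((contDiff_algHom c).pow _)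

theorem fderiv_partialSum (c : ℂ →ₐ[ℝ] ℂ) (a : ℕ → ℂ) (n : ℕ) (z v : ℂ) :
    fderiv ℝ (partialSum c a n) z v =
      ∑ k ∈ Finset.range n, c v * ((k + 1) * a k * c z ^ k) := by
  have h : HasFDerivAt (partialSum c a n) _ z :=
    HasFDerivAt.fun_sum fun k _ => ((hasFDerivAt_algHom c z).pow (k + 1)).const_mul (a k)
  rw [h.fderiv, sum_apply]
  refine Finset.sum_congr rfl fun k _ => ?_
  simp
  ring

theorem coeFn_sum_smul_zpow (c : ℂ →ₐ[ℝ] ℂ) (b : ℕ → ℂ) (g : ℕ → ℕ) (n : ℕ) :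
    (∑ k ∈ Finset.range n, b k • zpow c (g k) : L2Disk) =ᵐ[diskMeasure]
      fun z => ∑ k ∈ Finset.range n, b k * c z ^ g k := by
  induction n with
  | zero => simp only [Finset.range_zero, Finset.sum_empty]; exact Lp.coeFn_zero ℂ 2 diskMeasure
  | succ n ih =>
    simp only [Finset.sum_range_succ]
    filter_upwards [ih, Lp.coeFn_add (∑ k ∈ Finset.range n, b k • zpow c (g k) : L2Disk)
      (b n • zpow c (g n)), Lp.coeFn_smul (b n) (zpow c (g n)), coeFn_zpow c (g n)]
      with z h1 h2 h3 h4
    rw [h2, Pi.add_apply, h1, h3, Pi.smul_apply, h4, smul_eq_mul]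

theorem coeFn_sum_smul_fourierLp (b : ℕ → ℂ) (g : ℕ → ℤ) (n : ℕ) :
    (∑ k ∈ Finset.range n, b k • fourierLp 2 (g k) : L2Bdry) =ᵐ[bdryMeasure]
      fun β => ∑ k ∈ Finset.range n, b k * fourier (g k) β := by
  induction n with
  | zero => simp only [Finset.range_zero, Finset.sum_empty]; exact Lp.coeFn_zero ℂ 2 bdryMeasure
  | succ n ih =>
    simp only [Finset.sum_range_succ]
    filter_upwards [ih, Lp.coeFn_add (∑ k ∈ Finset.range n, b k • fourierLp 2 (g k) : L2Bdry)
      (b n • fourierLp 2 (g n)), Lp.coeFn_smul (b n) (fourierLp 2 (g n) : L2Bdry),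
      coeFn_fourierLp 2 (g n)] with z h1 h2 h3 h4
    rw [h2, Pi.add_apply, h1, h3, Pi.smul_apply, h4, smul_eq_mul]

/-- Summability bounds the coefficients, via x ≤ 1 + x², and a geometric series dominates. -/
theorem summable_powers (hc : IsSign c σ) {a : ℕ → ℂ}
    (ha : Summable fun k : ℕ => ‖a k‖ ^ 2 * (k + 1)) {z : ℂ} (hz : ‖z‖ < 1) :
    Summable fun k => a k * c z ^ (k + 1) := by
  have hbd : ∀ k, ‖a k * c z ^ (k + 1)‖ ≤ (1 + ∑' k : ℕ, ‖a k‖ ^ 2 * (k + 1)) * ‖z‖ ^ k := by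
    intro k
    have h1 : ‖a k‖ ^ 2 * (k + 1) ≤ ∑' k : ℕ, ‖a k‖ ^ 2 * (k + 1) :=
      ha.le_tsum k fun _ _ => by positivity
    have h2 : ‖a k‖ ≤ 1 + ∑' k : ℕ, ‖a k‖ ^ 2 * (k + 1) := by
      have : 0 ≤ ‖a k‖ ^ 2 * k := by positivity
      nlinarith [sq_nonneg (‖a k‖ - 1)]
    rw [norm_mul, norm_pow, hc.norm]
    exact mul_le_mul h2 (pow_le_pow_of_le_one (norm_nonneg _) hz.le k.le_succ) (by positivity)
      ((norm_nonneg _).trans h2)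
  exact .of_norm_bounded ((summable_geometric_of_lt_one (norm_nonneg _) hz).mul_left _) hbd

/-- A power series whose coefficients decay like those of an `H^{1/2}` function defines an element
of `H¹(M)`, with the expected trace. -/
theorem exists_series (hc : IsSign c σ) {a : ℕ → ℂ}
    (ha : Summable fun k : ℕ => ‖a k‖ ^ 2 * (k + 1)) {s : L2Bdry}
    (hs : HasSum (fun k : ℕ => a k • fourierLp 2 (σ * (k + 1))) s) :
    ∃ G : L2Disk, IsTrace G s ∧ G ∈ dKer c ∧
      ∀ᵐ z ∂diskMeasure, HasSum (fun k : ℕ => a k * c z ^ (k + 1)) (G z) := by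
  have hS := hc.summable_smul_zpow (g := fun k => k + 1) (add_left_injective 1) (b := a) (by
    refine Summable.of_nonneg_of_le (fun k => by positivity) (fun k => ?_) ha
    have h1 : (1 : ℝ) ≤ (k : ℝ) + 1 := by simp
    have h2 : (1 : ℝ) ≤ ((k + 1 : ℕ) : ℝ) + 1 := by simp; positivity
    exact (div_le_self (by positivity) h2).trans (le_mul_of_one_le_right (by positivity) h1))
  -- The differentiated term (k + 1) a_k (c z)^k has squared norm π(k + 1)|a_k|²: the hypothesis on
  -- a is exactly summability of the gradients.
  have hS' : ∀ v, Summable fun k : ℕ => (c v * ((k + 1) * a k)) • zpow c k := fun v =>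
    hc.summable_smul_zpow (g := fun k => k) (fun _ _ h => h) (by
      refine (ha.mul_left (‖c v‖ ^ 2)).congr fun k => ?_
      have : ‖(k + 1 : ℂ)‖ = k + 1 := by exact_mod_cast Complex.norm_natCast (k + 1)
      rw [norm_mul, norm_mul, this]
      field_simp)
  obtain ⟨G, hG⟩ := hS
  choose Gv hGv using hS'
  have h0 : Tendsto (fun n => eLpNorm (fun z => partialSum c a n z - G z) 2 diskMeasure)
      atTop (𝓝 0) :=
    tendsto_eLpNorm_of_tendsto (coeFn_sum_smul_zpow c a fun k => k + 1) hG.tendsto_sum_nat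
  have h1 : ∀ v, Tendsto (fun n => eLpNorm (fun z => fderiv ℝ (partialSum c a n) z v - Gv v z) 2
      diskMeasure) atTop (𝓝 0) := fun v =>
    tendsto_eLpNorm_of_tendsto (fun n => (coeFn_sum_smul_zpow c _ (fun k => k) n).trans
      (Eventually.of_forall fun z => by
        simp only [fderiv_partialSum]
        exact Finset.sum_congr rfl fun k _ => by ring)) (hGv v).tendsto_sum_nat
  have hus := contDiff_partialSum c a
  have hx := hasWeakDeriv_of_tendsto hus (Or.inl rfl) h0 (h1 1)
  have hy := hasWeakDeriv_of_tendsto hus (Or.inr rfl) h0 (h1 Complex.I)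
  refine ⟨G, ⟨partialSum c a, hus, ⟨h0, _, _, hx, hy, h1 1, h1 Complex.I⟩, ?_⟩, ?_, ?_⟩
  · refine tendsto_eLpNorm_of_tendsto (fun n => (coeFn_sum_smul_fourierLp a _ n).trans
      (Eventually.of_forall fun β => ?_)) hs.tendsto_sum_nat
    simp only [partialSum]
    refine Finset.sum_congr rfl fun k _ => ?_
    rw [hc.bdry, fourier_pow]
    push_cast
    rfl
  · rw [mem_dKer_iff hx hy]
    refine ((hGv 1).add ((hGv Complex.I).const_smul (c Complex.I))).unique ?_
    convert hasSum_zero with k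
    rw [smul_smul, ← add_smul, map_one]
    have := algHom_I_sq c
    rw [show 1 * (((k : ℂ) + 1) * a k) + c Complex.I * (c Complex.I * ((k + 1) * a k)) = 0 by
      linear_combination ((k + 1) * a k) * this, zero_smul]
  -- A subsequence of the partial sums converges to G almost everywhere, while the full series
  -- converges at every point of the disk; the two limits agree.
  · have hm := tendstoInMeasure_of_tendsto_eLpNorm (by simp)
      (fun n => (hus n).continuous.aestronglyMeasurable) (Lp.aestronglyMeasurable G) h0
    obtain ⟨ns, hns, hae⟩ := hm.exists_seq_tendsto_ae
    filter_upwards [hae, ae_restrict_mem measurableSet_ball] with z hz hzb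
    have hsum := (summable_powers hc ha (mem_ball_zero_iff.mp hzb)).hasSum
    rwa [← tendsto_nhds_unique (hsum.tendsto_sum_nat.comp hns.tendsto_atTop) hz]

/-! ### Estimates in a boundary layer -/

/-- The part `|z| ≥ 1 - δ` of the disk near the boundary, as a measure. -/
abbrev shellMeasure (δ : ℝ) : Measure ℂ := diskMeasure.restrict {z | 1 - δ ≤ ‖z‖}

theorem measurableSet_shell (δ : ℝ) : MeasurableSet {z : ℂ | 1 - δ ≤ ‖z‖} :=
  measurableSet_le measurable_const measurable_norm

theorem lintegral_shell_polar {δ : ℝ} (hδ : δ < 1) {F : ℂ → ℝ≥0∞} (hF : Measurable F) :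
    ∫⁻ z, F z ∂shellMeasure δ = ∫⁻ θ in Set.Ioo (-Real.pi) Real.pi,
      ∫⁻ r in Set.Ico (1 - δ) 1, ENNReal.ofReal r * F (polarPoint (r, θ)) := by
  have hA := measurableSet_shell δ
  have hm : MeasurableSet disk := measurableSet_ball
  have hT : MeasurableSet polarCoord.target := polarCoord.open_target.measurableSet
  have hS : MeasurableSet (Set.Ico (1 - δ) 1 ×ˢ Set.Ioo (-Real.pi) Real.pi) :=
    measurableSet_Ico.prod measurableSet_Ioo
  have hmeas : Measurable fun p : ℝ × ℝ => ENNReal.ofReal p.1 * F (polarPoint p) :=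
    (ENNReal.measurable_ofReal.comp measurable_fst).mul
      (hF.comp contDiff_polarPoint.continuous.measurable)
  rw [shellMeasure, diskMeasure, Measure.restrict_restrict hA, ← lintegral_indicator (hA.inter hm),
    ← Complex.lintegral_comp_polarCoord_symm]
  have key : ∫⁻ p in polarCoord.target, ENNReal.ofReal p.1 •
        ({z : ℂ | 1 - δ ≤ ‖z‖} ∩ disk).indicator F (Complex.polarCoord.symm p) =
      ∫⁻ p in Set.Ico (1 - δ) 1 ×ˢ Set.Ioo (-Real.pi) Real.pi,
        ENNReal.ofReal p.1 * F (polarPoint p) := by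
    rw [← lintegral_indicator hT, ← lintegral_indicator hS]
    congr 1
    ext p
    by_cases hp : p ∈ polarCoord.target
    · rw [Set.indicator_of_mem hp, ← polarPoint_eq]
      rw [polarCoord_target, Set.mem_prod] at hp
      have hn : ‖polarPoint p‖ = p.1 := by rw [norm_polarPoint, abs_of_pos hp.1]
      by_cases h1 : p.1 ∈ Set.Ico (1 - δ) 1
      · rw [Set.indicator_of_mem, Set.indicator_of_mem, smul_eq_mul]
        · exact ⟨h1, hp.2⟩
        · refine ⟨?_, ?_⟩
          · simpa only [Set.mem_ofPred_eq, hn] using h1.1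
          · rw [mem_ball_zero_iff, hn]; exact h1.2
      · rw [Set.indicator_of_notMem, Set.indicator_of_notMem, smul_zero]
        · exact fun h => h1 h.1
        · rintro ⟨ha, hb⟩
          rw [mem_ball_zero_iff, hn] at hb
          exact h1 ⟨by simpa only [Set.mem_ofPred_eq, hn] using ha, hb⟩
    · rw [Set.indicator_of_notMem hp, Set.indicator_of_notMem]
      exact fun h => hp ⟨lt_of_lt_of_le (by linarith) h.1.1, h.2⟩
  rw [key, Measure.volume_eq_prod, ← Measure.prod_restrict,
    lintegral_prod_symm _ hmeas.aemeasurable]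

/-- Cauchy–Schwarz against the constant 1. -/
theorem sq_lintegral_le {α : Type*} [MeasurableSpace α] (μ : Measure α) {h : α → ℝ≥0∞}
    (hh : AEMeasurable h μ) : (∫⁻ a, h a ∂μ) ^ 2 ≤ μ Set.univ * ∫⁻ a, h a ^ 2 ∂μ := by
  have key := ENNReal.lintegral_mul_le_Lp_mul_Lq μ Real.HolderConjugate.two_two hh
    (aemeasurable_const (b := (1 : ℝ≥0∞)))
  simp only [Pi.mul_apply, mul_one, ENNReal.one_rpow, lintegral_const, one_mul] at key
  have h2 : ∀ x : ℝ≥0∞, (x ^ (1 / 2 : ℝ)) ^ 2 = x := fun x => by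
    rw [← ENNReal.rpow_natCast, ← ENNReal.rpow_mul]; norm_num
  refine (pow_le_pow_left' key 2).trans (le_of_eq ?_)
  rw [mul_pow, h2, h2, mul_comm]
  simp

theorem eLpNorm_two_sq {α : Type*} [MeasurableSpace α] (μ : Measure α) (f : α → ℂ) :
    eLpNorm f 2 μ ^ 2 = ∫⁻ x, ‖f x‖ₑ ^ 2 ∂μ := by
  simpa using eLpNorm_nnreal_pow_eq_lintegral (μ := μ) (f := f) (p := 2) two_ne_zero

theorem ennreal_add_sq_le (a b : ℝ≥0∞) : (a + b) ^ 2 ≤ 2 * (a ^ 2 + b ^ 2) := by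
  induction a with
  | top => simp
  | coe a =>
    induction b with
    | top => simp
    | coe b => exact_mod_cast add_sq_le (a := a) (b := b)

theorem hasDerivAt_radial {u : ℂ → ℂ} (hu : ContDiff ℝ ∞ u) (θ s : ℝ) :
    HasDerivAt (fun s : ℝ => u (polarPoint (s, θ)))
      (Real.cos θ * fderiv ℝ u (polarPoint (s, θ)) 1 +
        Real.sin θ * fderiv ℝ u (polarPoint (s, θ)) Complex.I) s := by
  have h1 : HasDerivAt (fun s : ℝ => polarPoint (s, θ))
      (1 * (Real.cos θ + Real.sin θ * Complex.I)) s :=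
    (Complex.ofRealCLM.hasDerivAt (x := s)).mul_const (Real.cos θ + Real.sin θ * Complex.I : ℂ)
  have h2 := (hu.differentiable (by simp) (polarPoint (s, θ))).hasFDerivAt.comp_hasDerivAt s h1
  rw [fderiv_apply_eq] at h2
  simp only [one_mul, Complex.add_re, Complex.add_im, Complex.mul_re, Complex.mul_im,
    Complex.ofReal_re, Complex.ofReal_im, Complex.I_re, Complex.I_im, mul_zero, mul_one, sub_zero,
    add_zero, zero_add] at h2
  exact h2

/-- The pointwise size of the gradient. -/
def gradNorm (u : ℂ → ℂ) (z : ℂ) : ℝ≥0∞ := ‖fderiv ℝ u z 1‖ₑ + ‖fderiv ℝ u z Complex.I‖ₑ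

theorem measurable_gradNorm {u : ℂ → ℂ} (hu : ContDiff ℝ ∞ u) : Measurable (gradNorm u) := by
  have h := hu.continuous_fderiv (by simp)
  exact ((h.clm_apply continuous_const).measurable.enorm).add
    ((h.clm_apply continuous_const).measurable.enorm)

/-- The fundamental theorem of calculus along the radius from r to 1, with |cos θ| and |sin θ| at
most 1. -/
theorem enorm_radial_le {u : ℂ → ℂ} (hu : ContDiff ℝ ∞ u) (θ : ℝ) {δ r : ℝ}
    (hr : r ∈ Set.Ico (1 - δ) 1) :
    ‖u (polarPoint (r, θ))‖ₑ ≤ ‖u (polarPoint (1, θ))‖ₑ +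
      ∫⁻ s in Set.Ico (1 - δ) 1, gradNorm u (polarPoint (s, θ)) := by
  set D : ℝ → ℂ := fun s => Real.cos θ * fderiv ℝ u (polarPoint (s, θ)) 1 +
        Real.sin θ * fderiv ℝ u (polarPoint (s, θ)) Complex.I
  have hp : Continuous fun s : ℝ => polarPoint (s, θ) :=
    contDiff_polarPoint.continuous.comp (by fun_prop)
  have hD : Continuous D := by
    have h := (hu.continuous_fderiv (by simp)).comp hp
    exact (continuous_const.mul (h.clm_apply continuous_const)).add
      (continuous_const.mul (h.clm_apply continuous_const))
  have hftc := intervalIntegral.integral_eq_sub_of_hasDerivAt (a := r) (b := 1)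
    (fun s _ => hasDerivAt_radial hu θ s) (hD.intervalIntegrable _ _)
  have heq : u (polarPoint (r, θ)) = u (polarPoint (1, θ)) - ∫ s in r..1, D s := by
    rw [hftc]; ring
  rw [heq]
  refine (enorm_sub_le).trans (add_le_add le_rfl ?_)
  rw [intervalIntegral.integral_of_le hr.2.le, integral_Ioc_eq_integral_Ioo]
  refine (enorm_integral_le_lintegral_enorm _).trans ?_
  refine (lintegral_mono_set (?_ : Set.Ioo r 1 ⊆ Set.Ico (1 - δ) 1)).trans
    (lintegral_mono fun s => ?_)
  · exact fun s hs => ⟨hr.1.trans hs.1.le, hs.2⟩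
  · refine (enorm_add_le _ _).trans (add_le_add ?_ ?_) <;> rw [enorm_mul] <;>
      refine mul_le_of_le_one_left' ?_
    · rw [← enorm_norm, Complex.norm_real, enorm_norm, Real.enorm_eq_ofReal_abs]
      exact ENNReal.ofReal_le_one.mpr (Real.abs_cos_le_one θ)
    · rw [← enorm_norm, Complex.norm_real, enorm_norm, Real.enorm_eq_ofReal_abs]
      exact ENNReal.ofReal_le_one.mpr (Real.abs_sin_le_one θ)

/-- A Hardy type inequality near the boundary. -/
theorem lintegral_shell_le {u : ℂ → ℂ} (hu : ContDiff ℝ ∞ u) {δ : ℝ} (hδ : δ ≤ 1 / 2) :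
    ∫⁻ z, ‖u z‖ₑ ^ 2 ∂shellMeasure δ ≤
      2 * ENNReal.ofReal δ *
        (∫⁻ θ in Set.Ioo (-Real.pi) Real.pi, ‖u (polarPoint (1, θ))‖ₑ ^ 2) +
      4 * ENNReal.ofReal δ ^ 2 * ∫⁻ z, gradNorm u z ^ 2 ∂shellMeasure δ := by
  have hg := measurable_gradNorm hu
  have hpm := contDiff_polarPoint.continuous.measurable
  rw [lintegral_shell_polar (by linarith) (hu.continuous.measurable.enorm.pow_const 2),
    lintegral_shell_polar (by linarith) (hg.pow_const 2)]
  have hvol : (volume.restrict (Set.Ico (1 - δ) 1)) Set.univ = ENNReal.ofReal δ := by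
    rw [Measure.restrict_apply_univ, Real.volume_Ico]; congr 1; ring
  have hmθ : Measurable fun θ : ℝ => ‖u (polarPoint (1, θ))‖ₑ ^ 2 :=
    ((hu.continuous.comp contDiff_polarPoint.continuous).comp
      (by fun_prop : Continuous fun θ : ℝ => ((1 : ℝ), θ))).measurable.enorm.pow_const 2
  rw [← lintegral_const_mul _ hmθ, ← lintegral_const_mul']
  · rw [← lintegral_add_left (hmθ.const_mul _)]
    refine lintegral_mono fun θ => ?_
    have hgm : Measurable fun s : ℝ => gradNorm u (polarPoint (s, θ)) :=
      hg.comp (hpm.comp (by fun_prop : Measurable fun s : ℝ => (s, θ)))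
    set K := ∫⁻ r in Set.Ico (1 - δ) 1, ENNReal.ofReal r * gradNorm u (polarPoint (r, θ)) ^ 2
    -- As δ ≤ 1/2, the layer has r ≥ 1/2, so the polar weight r can be inserted at the cost of a
    -- factor 2.
    have hK : ∫⁻ r in Set.Ico (1 - δ) 1, gradNorm u (polarPoint (r, θ)) ^ 2 ≤ 2 * K := by
      rw [← lintegral_const_mul' _ _ (by simp)]
      refine setLIntegral_mono' measurableSet_Ico fun r hr => ?_
      rw [← mul_assoc]
      refine le_mul_of_one_le_left' ?_
      rw [← ENNReal.ofReal_one, show (2 : ℝ≥0∞) = ENNReal.ofReal 2 by simp,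
        ← ENNReal.ofReal_mul (by norm_num)]
      exact ENNReal.ofReal_le_ofReal (by linarith [hr.1])
    -- Cauchy–Schwarz on a radial interval of length δ gives one factor δ on the gradient term;
    -- integrating this bound in r gives another factor δ on both terms.
    have hpt : ∀ r ∈ Set.Ico (1 - δ) 1, ENNReal.ofReal r * ‖u (polarPoint (r, θ))‖ₑ ^ 2 ≤
        2 * (‖u (polarPoint (1, θ))‖ₑ ^ 2 + ENNReal.ofReal δ * (2 * K)) := by
      intro r hr
      refine (mul_le_of_le_one_left' (ENNReal.ofReal_le_one.mpr hr.2.le)).trans ?_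
      refine (pow_le_pow_left' (enorm_radial_le hu θ hr) 2).trans ?_
      refine (ennreal_add_sq_le _ _).trans ?_
      gcongr
      refine (sq_lintegral_le _ hgm.aemeasurable).trans ?_
      rw [hvol]
      gcongr
    refine (setLIntegral_mono' measurableSet_Ico hpt).trans (le_of_eq ?_)
    rw [lintegral_const, hvol]
    ring
  · finiteness

theorem lintegral_bdry (F : BdryCircle → ℝ≥0∞) :
    ∫⁻ θ in Set.Ioo (-Real.pi) Real.pi, F (θ : ℝ) =
      ENNReal.ofReal (2 * Real.pi) * ∫⁻ β, F β ∂bdryMeasure := by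
  have h := AddCircle.lintegral_preimage (2 * Real.pi) (-Real.pi) F
  rw [show -Real.pi + 2 * Real.pi = Real.pi by ring, AddCircle.volume_eq_smul_haarAddCircle,
    lintegral_smul_measure] at h
  refine Eq.trans ?_ h
  exact setLIntegral_congr Ioo_ae_eq_Ioc

theorem eLpNorm_shell_le {u : ℂ → ℂ} (hu : ContDiff ℝ ∞ u) {δ : ℝ} (hδ0 : 0 ≤ δ)
    (hδ : δ ≤ 1 / 2) :
    eLpNorm u 2 (shellMeasure δ) ≤ 4 * eLpNorm (fun β => u (bdryPoint β)) 2 bdryMeasure +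
      4 * ENNReal.ofReal δ * (eLpNorm (fun z => fderiv ℝ u z 1) 2 (shellMeasure δ) +
        eLpNorm (fun z => fderiv ℝ u z Complex.I) 2 (shellMeasure δ)) := by
  set b := eLpNorm (fun β => u (bdryPoint β)) 2 bdryMeasure with hb
  set x := eLpNorm (fun z => fderiv ℝ u z 1) 2 (shellMeasure δ) with hx
  set y := eLpNorm (fun z => fderiv ℝ u z Complex.I) 2 (shellMeasure δ) with hy
  set d := ENNReal.ofReal δ with hd
  have h := lintegral_shell_le hu hδ
  simp only [← bdryPoint_coe] at h
  rw [lintegral_bdry (fun β => ‖u (bdryPoint β)‖ₑ ^ 2), ← eLpNorm_two_sq, ← eLpNorm_two_sq,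
    ← hb] at h
  have hgrad : ∫⁻ z, gradNorm u z ^ 2 ∂shellMeasure δ ≤ 2 * (x ^ 2 + y ^ 2) := by
    rw [hx, hy, eLpNorm_two_sq, eLpNorm_two_sq, ← lintegral_add_left', ← lintegral_const_mul']
    · exact lintegral_mono fun z => ennreal_add_sq_le _ _
    · simp
    · exact (aesm_fderiv hu 1 _).enorm.pow_const 2
  have hconst : 2 * d * ENNReal.ofReal (2 * Real.pi) ≤ 4 ^ 2 := by
    rw [hd, show (2 : ℝ≥0∞) = ENNReal.ofReal 2 by simp, ← ENNReal.ofReal_mul (by norm_num),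
      ← ENNReal.ofReal_mul (by positivity), show (4 : ℝ≥0∞) ^ 2 = ENNReal.ofReal 16 by norm_num]
    refine ENNReal.ofReal_le_ofReal ?_
    nlinarith [Real.pi_pos, Real.pi_lt_four]
  -- The constants are rounded up to 16, and cross terms are added, so that the bound becomes a
  -- perfect square.
  have hsq : eLpNorm u 2 (shellMeasure δ) ^ 2 ≤ (4 * b + 4 * d * (x + y)) ^ 2 := by
    calc _ ≤ 2 * d * (ENNReal.ofReal (2 * Real.pi) * b ^ 2) +
          4 * d ^ 2 * (2 * (x ^ 2 + y ^ 2)) := h.trans (by gcongr)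
      _ = 2 * d * ENNReal.ofReal (2 * Real.pi) * b ^ 2 + 8 * d ^ 2 * (x ^ 2 + y ^ 2) := by ring
      _ ≤ 4 ^ 2 * b ^ 2 + 16 * d ^ 2 * (x ^ 2 + y ^ 2) := by gcongr; norm_num
      _ ≤ 4 ^ 2 * b ^ 2 + 16 * d ^ 2 * (x ^ 2 + y ^ 2) +
          (32 * d ^ 2 * x * y + 32 * b * d * (x + y)) := le_self_add
      _ = _ := by ring
  exact (ENNReal.pow_le_pow_left_iff two_ne_zero).mp hsq

/-! ### Cutoffs and functions of vanishing trace -/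

/-- A smooth cutoff function, equal to `1` for `|z|² ≤ 1 - δ` and to `0` for `|z|² ≥ 1 - δ / 2`. -/
def cutoff (δ : ℝ) (z : ℂ) : ℝ := Real.smoothTransition (2 * (1 - ‖z‖ ^ 2) / δ - 1)

theorem contDiff_cutoff (δ : ℝ) : ContDiff ℝ ∞ (cutoff δ) :=
  Real.smoothTransition.contDiff.comp
    (((contDiff_const.mul (contDiff_const.sub (contDiff_norm_sq ℝ))).div_const δ).sub contDiff_const)

theorem cutoff_eq_one {δ : ℝ} (hδ : 0 < δ) {z : ℂ} (hz : ‖z‖ < 1 - δ) : cutoff δ z = 1 := by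
  refine Real.smoothTransition.one_of_one_le ?_
  rw [le_sub_iff_add_le, le_div_iff₀ hδ]
  nlinarith [norm_nonneg z]

theorem cutoff_nonneg (δ : ℝ) (z : ℂ) : 0 ≤ cutoff δ z := Real.smoothTransition.nonneg _

theorem cutoff_le_one (δ : ℝ) (z : ℂ) : cutoff δ z ≤ 1 := Real.smoothTransition.le_one _

theorem isTest_cutoff_mul {δ : ℝ} (hδ : 0 < δ) {u : ℂ → ℂ} (hu : ContDiff ℝ ∞ u) :
    IsTest fun z => cutoff δ z * u z := by
  have hsub : tsupport (fun z => (cutoff δ z : ℂ) * u z) ⊆ {z : ℂ | ‖z‖ ^ 2 ≤ 1 - δ / 2} := by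
    refine closure_minimal (fun z hz => ?_) (isClosed_le (by fun_prop) continuous_const)
    by_contra hlt
    refine hz ?_
    have h0 : cutoff δ z = 0 := by
      refine Real.smoothTransition.zero_of_nonpos ?_
      rw [sub_nonpos, div_le_one hδ]
      have : ¬ ‖z‖ ^ 2 ≤ 1 - δ / 2 := hlt
      linarith
    simp [h0]
  have hball : {z : ℂ | ‖z‖ ^ 2 ≤ 1 - δ / 2} ⊆ disk := fun z hz => by
    rw [mem_ball_zero_iff]
    have : ‖z‖ ^ 2 ≤ 1 - δ / 2 := hz
    nlinarith [norm_nonneg z]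
  refine ⟨(Complex.ofRealCLM.contDiff.comp (contDiff_cutoff δ)).mul hu, ?_, hsub.trans hball⟩
  exact HasCompactSupport.of_support_subset_isCompact (isCompact_closedBall (0 : ℂ) 1)
    ((subset_tsupport _).trans ((hsub.trans hball).trans Metric.ball_subset_closedBall))

theorem exists_deriv_smoothTransition_bound :
    ∃ K : ℝ, 0 ≤ K ∧ ∀ x, |deriv Real.smoothTransition x| ≤ K := by
  have hc : Continuous (deriv Real.smoothTransition) :=
    (Real.smoothTransition.contDiff (n := 1)).continuous_deriv (by simp)
  have hsupp : HasCompactSupport (deriv Real.smoothTransition) := by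
    refine HasCompactSupport.intro (isCompact_Icc (a := (0 : ℝ)) (b := 1)) fun x hx => ?_
    rw [Set.mem_Icc, not_and_or, not_le, not_le] at hx
    rcases hx with hx | hx
    · have : Real.smoothTransition =ᶠ[𝓝 x] fun _ => 0 := by
        filter_upwards [Iio_mem_nhds hx] with y hy
        exact Real.smoothTransition.zero_of_nonpos (le_of_lt hy)
      rw [this.deriv_eq, deriv_const]
    · have : Real.smoothTransition =ᶠ[𝓝 x] fun _ => 1 := by
        filter_upwards [Ioi_mem_nhds hx] with y hy
        exact Real.smoothTransition.one_of_one_le (le_of_lt hy)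
      rw [this.deriv_eq, deriv_const]
  obtain ⟨K, hK⟩ := hsupp.exists_bound_of_continuous hc
  exact ⟨K, (norm_nonneg _).trans (hK 0), hK⟩

theorem fderiv_cutoff_eq_zero {δ : ℝ} (hδ : 0 < δ) {z : ℂ} (hz : ‖z‖ < 1 - δ) :
    fderiv ℝ (cutoff δ) z = 0 := by
  have : cutoff δ =ᶠ[𝓝 z] fun _ => 1 := by
    filter_upwards [(isOpen_lt continuous_norm continuous_const).mem_nhds hz] with w hw
    exact cutoff_eq_one hδ hw
  rw [this.fderiv_eq, fderiv_const_apply]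

theorem exists_fderiv_cutoff_bound : ∃ K : ℝ, 0 ≤ K ∧ ∀ δ : ℝ, 0 < δ → ∀ z : ℂ, ‖z‖ ≤ 1 →
    ∀ v : ℂ, ‖v‖ ≤ 1 → |fderiv ℝ (cutoff δ) z v| ≤ K / δ := by
  obtain ⟨K, hK0, hK⟩ := exists_deriv_smoothTransition_bound
  -- The argument of the transition function has derivative -4⟨z, v⟩/δ, whence the factor 4.
  refine ⟨4 * K, by positivity, fun δ hδ z hz v hv => ?_⟩
  have h1 : HasFDerivAt (fun z : ℂ => 2 * (1 - ‖z‖ ^ 2) / δ - 1) _ z :=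
    ((((hasStrictFDerivAt_norm_sq z).hasFDerivAt.const_sub 1).const_mul 2).mul_const δ⁻¹).sub_const 1
  have hst := (Real.smoothTransition.contDiff (n := 1)).differentiable (by simp)
    (2 * (1 - ‖z‖ ^ 2) / δ - 1)
  have h2 : HasFDerivAt (cutoff δ) _ z := hst.hasDerivAt.comp_hasFDerivAt z h1
  rw [h2.fderiv]
  simp only [smul_apply, neg_apply, smul_eq_mul, innerSL_apply_apply, nsmul_eq_mul]
  have hin : |inner ℝ z v| ≤ 1 :=
    (abs_real_inner_le_norm z v).trans (mul_le_one₀ hz (norm_nonneg _) hv)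
  generalize inner ℝ z v = i at hin ⊢
  have hi : |δ⁻¹ * (2 * -((2 : ℕ) * i))| ≤ 4 / δ := by
    rw [show δ⁻¹ * (2 * -((2 : ℕ) * i)) = -(4 / δ * i) by push_cast; ring, abs_neg, abs_mul,
      abs_of_pos (by positivity)]
    exact mul_le_of_le_one_right (by positivity) hin
  rw [abs_mul]
  calc _ ≤ K * (4 / δ) := mul_le_mul (hK _) hi (abs_nonneg _) hK0
    _ = _ := by ring

theorem fderiv_cutoff_mul (δ : ℝ) {u : ℂ → ℂ} (hu : ContDiff ℝ ∞ u) (z v : ℂ) :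
    fderiv ℝ (fun z => cutoff δ z * u z) z v =
      cutoff δ z * fderiv ℝ u z v + fderiv ℝ (cutoff δ) z v * u z := by
  have h1 : HasFDerivAt (fun z => (cutoff δ z : ℂ)) _ z :=
    Complex.ofRealCLM.hasFDerivAt.comp z
      ((contDiff_cutoff δ).differentiable (by simp) z).hasFDerivAt
  have h2 := (hu.differentiable (by simp) z).hasFDerivAt
  have h3 : HasFDerivAt (fun z => cutoff δ z * u z) _ z := h1.mul h2
  rw [h3.fderiv]
  simp
  ring

theorem measurable_cutoff (δ : ℝ) (μ : Measure ℂ) :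
    AEStronglyMeasurable (fun z => (cutoff δ z : ℂ)) μ :=
  (Complex.continuous_ofReal.comp (contDiff_cutoff δ).continuous).aestronglyMeasurable

/-- With χ the cutoff, χw - g = χ(w - g) + (χ - 1)g, and χ - 1 vanishes off the layer. -/
theorem eLpNorm_cutoff_mul_sub_le {δ : ℝ} (hδ : 0 < δ) {w : ℂ → ℂ} (hw : Continuous w)
    (g : L2Disk) :
    eLpNorm (fun z => cutoff δ z * w z - g z) 2 diskMeasure ≤
      eLpNorm (fun z => w z - g z) 2 diskMeasure + eLpNorm g 2 (shellMeasure δ) := by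
  have hg := Lp.aestronglyMeasurable g
  have h : (fun z => cutoff δ z * w z - g z) =
      (fun z => cutoff δ z * (w z - g z)) + fun z => (cutoff δ z - 1) * g z := by
    ext z
    simp only [Pi.add_apply]
    ring
  rw [h]
  refine (eLpNorm_add_le ((measurable_cutoff δ _).mul (hw.aestronglyMeasurable.sub hg))
    (((measurable_cutoff δ _).sub aestronglyMeasurable_const).mul hg) (by simp)).trans
    (add_le_add (eLpNorm_mono fun z => ?_) ?_)
  · change ‖(cutoff δ z : ℂ) * (w z - g z)‖ ≤ _
    rw [norm_mul, Complex.norm_real, Real.norm_of_nonneg (cutoff_nonneg _ _)]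
    exact mul_le_of_le_one_left (norm_nonneg _) (cutoff_le_one _ _)
  · rw [← eLpNorm_indicator_eq_eLpNorm_restrict (measurableSet_shell δ)]
    refine eLpNorm_mono fun z => ?_
    change ‖((cutoff δ z : ℂ) - 1) * g z‖ ≤ _
    by_cases hz : 1 - δ ≤ ‖z‖
    · rw [Set.indicator_of_mem (by exact hz), norm_mul]
      refine mul_le_of_le_one_left (norm_nonneg _) ?_
      rw [← Complex.ofReal_one, ← Complex.ofReal_sub, Complex.norm_real, Real.norm_eq_abs, abs_le]
      constructor <;> linarith [cutoff_nonneg δ z, cutoff_le_one δ z]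
    · rw [cutoff_eq_one hδ (not_le.mp hz)]
      simp

theorem eLpNorm_fderiv_cutoff_mul_le {δ K : ℝ} (hδ : 0 < δ) (hK0 : 0 ≤ K)
    (hK : ∀ z : ℂ, ‖z‖ ≤ 1 → ∀ v : ℂ, ‖v‖ ≤ 1 → |fderiv ℝ (cutoff δ) z v| ≤ K / δ)
    {u : ℂ → ℂ} {v : ℂ} (hv : ‖v‖ ≤ 1) :
    eLpNorm (fun z => fderiv ℝ (cutoff δ) z v * u z) 2 diskMeasure ≤
      ENNReal.ofReal (K / δ) * eLpNorm u 2 (shellMeasure δ) := by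
  rw [← eLpNorm_indicator_eq_eLpNorm_restrict (measurableSet_shell δ)]
  refine eLpNorm_le_mul_eLpNorm_of_ae_le_mul ?_ 2
  filter_upwards [ae_restrict_mem measurableSet_ball] with z hz
  by_cases h : 1 - δ ≤ ‖z‖
  · rw [Set.indicator_of_mem (by exact h), norm_mul, Complex.norm_real]
    gcongr
    exact hK z (mem_ball_zero_iff.mp hz).le v hv
  · rw [fderiv_cutoff_eq_zero hδ (not_le.mp h)]
    simp
    positivity

/-- Absolute continuity of the integral, as the area of the layer tends to zero. -/
theorem tendsto_eLpNorm_shell (g : L2Disk) {δ : ℕ → ℝ} (hδ0 : ∀ n, 0 < δ n)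
    (hδ : Tendsto δ atTop (𝓝 0)) :
    Tendsto (fun n => eLpNorm g 2 (shellMeasure (δ n))) atTop (𝓝 0) := by
  have hvol : Tendsto (diskMeasure ∘ fun n => {z : ℂ | 1 - δ n ≤ ‖z‖}) atTop (𝓝 0) := by
    have heq : ∀ n, diskMeasure {z : ℂ | 1 - δ n ≤ ‖z‖} =
        ENNReal.ofReal 1 ^ 2 * NNReal.pi - ENNReal.ofReal (1 - δ n) ^ 2 * NNReal.pi := by
      intro n
      have hset : {z : ℂ | 1 - δ n ≤ ‖z‖} ∩ disk = disk \ Metric.ball 0 (1 - δ n) := by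
        ext z
        simp only [Set.mem_inter_iff, Set.mem_ofPred_eq, mem_ball_zero_iff, Set.mem_sdiff, not_lt]
        exact and_comm
      rw [diskMeasure, Measure.restrict_apply (measurableSet_shell _), hset,
        measure_sdiff (Metric.ball_subset_ball (by linarith [hδ0 n]))
          measurableSet_ball.nullMeasurableSet measure_ball_lt_top.ne,
        Complex.volume_ball, Complex.volume_ball]
    have h1 : Tendsto (fun n => ENNReal.ofReal (1 - δ n) ^ 2 * NNReal.pi) atTop
        (𝓝 (ENNReal.ofReal 1 ^ 2 * NNReal.pi)) := by
      refine ENNReal.Tendsto.mul_const (ENNReal.Tendsto.pow (ENNReal.tendsto_ofReal ?_))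
        (Or.inr ENNReal.coe_ne_top)
      simpa using tendsto_const_nhds (x := (1 : ℝ)) |>.sub hδ
    have h2 := ENNReal.Tendsto.sub (tendsto_const_nhds (x := ENNReal.ofReal 1 ^ 2 * NNReal.pi)
      (f := atTop)) h1 (Or.inl (by finiteness))
    rw [tsub_self] at h2
    exact h2.congr fun n => (heq n).symm
  have hfin : ∫⁻ z, ‖g z‖ₑ ^ 2 ∂diskMeasure ≠ ⊤ := by
    rw [← eLpNorm_two_sq]
    exact ENNReal.pow_ne_top (Lp.memLp g).eLpNorm_ne_top
  have h := (tendsto_setLIntegral_zero hfin hvol).ennrpow_const (1 / 2)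
  rw [ENNReal.zero_rpow_of_pos (by norm_num)] at h
  refine h.congr fun n => ?_
  rw [← eLpNorm_two_sq, ← ENNReal.rpow_natCast, ← ENNReal.rpow_mul,
    show ((2 : ℕ) : ℝ) * (1 / 2) = 1 by norm_num, ENNReal.rpow_one]

/-- An `H¹` function with vanishing trace belongs to `H¹₀`. -/
theorem IsTrace.mem_H10 {f : L2Disk} (h : IsTrace f 0) : f ∈ H10 := by
  obtain ⟨u, hus, ⟨h0, fx, fy, hx, hy, h1, h2⟩, hb⟩ := h
  obtain ⟨K, hK0, hK⟩ := exists_fderiv_cutoff_bound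
  set δ : ℕ → ℝ := fun n => 1 / ((n : ℝ) + 2)
  have hδ0 : ∀ n, 0 < δ n := fun n => by positivity
  have hδ2 : ∀ n, δ n ≤ 1 / 2 := fun n =>
    one_div_le_one_div_of_le (by norm_num) (by linarith [n.cast_nonneg (α := ℝ)])
  have hδ : Tendsto δ atTop (𝓝 0) :=
    tendsto_const_nhds.div_atTop (tendsto_natCast_atTop_atTop.atTop_add tendsto_const_nhds)
  have hb' : Tendsto (fun n => eLpNorm (fun β => u n (bdryPoint β)) 2 bdryMeasure) atTop (𝓝 0) := by
    refine hb.congr fun n => eLpNorm_congr_ae ?_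
    filter_upwards [Lp.coeFn_zero ℂ 2 bdryMeasure] with β hβ
    rw [hβ, Pi.zero_apply, sub_zero]
  -- The approximant is chosen after δ, with boundary norm at most δ², so that this norm stays
  -- negligible after multiplication by the cutoff gradient K/δ.
  have hchoose : ∀ n, ∃ m ≥ n, eLpNorm (fun β => u m (bdryPoint β)) 2 bdryMeasure ≤
      ENNReal.ofReal (δ n ^ 2) := fun n => by
    have hpos : 0 < ENNReal.ofReal (δ n ^ 2) := ENNReal.ofReal_pos.mpr (pow_pos (hδ0 n) 2)
    obtain ⟨m, hm⟩ := ((hb'.eventually_le_const hpos).and (eventually_ge_atTop n)).exists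
    exact ⟨m, hm.2, hm.1⟩
  choose m hmn hm using hchoose
  have hmt : Tendsto m atTop atTop := tendsto_atTop_mono hmn tendsto_id
  set X : ℕ → ℝ≥0∞ := fun n => eLpNorm (fun z => fderiv ℝ (u (m n)) z 1 - fx z) 2 diskMeasure
  set Y : ℕ → ℝ≥0∞ := fun n =>
    eLpNorm (fun z => fderiv ℝ (u (m n)) z Complex.I - fy z) 2 diskMeasure
  set SX : ℕ → ℝ≥0∞ := fun n => eLpNorm fx 2 (shellMeasure (δ n))
  set SY : ℕ → ℝ≥0∞ := fun n => eLpNorm fy 2 (shellMeasure (δ n))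
  have hX : Tendsto X atTop (𝓝 0) := h1.comp hmt
  have hY : Tendsto Y atTop (𝓝 0) := h2.comp hmt
  have hSX : Tendsto SX atTop (𝓝 0) := tendsto_eLpNorm_shell fx hδ0 hδ
  have hSY : Tendsto SY atTop (𝓝 0) := tendsto_eLpNorm_shell fy hδ0 hδ
  have hgrad : ∀ n (g : L2Disk) v, eLpNorm (fun z => fderiv ℝ (u (m n)) z v) 2 (shellMeasure (δ n)) ≤
      eLpNorm (fun z => fderiv ℝ (u (m n)) z v - g z) 2 diskMeasure +
        eLpNorm g 2 (shellMeasure (δ n)) := fun n g v => by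
    have hg := (Lp.aestronglyMeasurable g).restrict (s := {z | 1 - δ n ≤ ‖z‖})
    have heq : (fun z => fderiv ℝ (u (m n)) z v) =
      (fun z => fderiv ℝ (u (m n)) z v - g z) + g := by ext z; simp
    rw [heq]
    refine (eLpNorm_add_le ((aesm_fderiv (hus _) v _).sub hg) hg (by simp)).trans
      (add_le_add ?_ le_rfl)
    exact eLpNorm_mono_measure _ Measure.restrict_le_self
  -- This is (K/δ)(4δ² + 4δ·G), where G bounds the gradient norm on the layer. The 1/δ cancels, and
  -- G tends to zero because the layer shrinks.
  set E : ℕ → ℝ≥0∞ := fun n => ENNReal.ofReal (4 * K * δ n) +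
    ENNReal.ofReal (4 * K) * ((X n + SX n) + (Y n + SY n)) with hE
  have hEt : Tendsto E atTop (𝓝 0) := by
    have e1 : Tendsto (fun n => ENNReal.ofReal (4 * K * δ n)) atTop (𝓝 0) := by
      have := ENNReal.tendsto_ofReal (hδ.const_mul (4 * K))
      rwa [mul_zero, ENNReal.ofReal_zero] at this
    have e2 := ENNReal.Tendsto.const_mul (a := ENNReal.ofReal (4 * K))
      ((hX.add hSX).add (hY.add hSY)) (Or.inr ENNReal.ofReal_ne_top)
    have e3 := e1.add e2
    simp only [add_zero, mul_zero] at e3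
    exact e3
  have hcut : ∀ n v, ‖v‖ ≤ 1 →
      eLpNorm (fun z => fderiv ℝ (cutoff (δ n)) z v * u (m n) z) 2 diskMeasure ≤ E n := by
    intro n v hv
    have hsh := eLpNorm_shell_le (hus (m n)) (hδ0 n).le (hδ2 n)
    refine (eLpNorm_fderiv_cutoff_mul_le (hδ0 n) hK0 (hK _ (hδ0 n)) hv).trans ?_
    calc _ ≤ ENNReal.ofReal (K / δ n) * (4 * ENNReal.ofReal (δ n ^ 2) +
          4 * ENNReal.ofReal (δ n) * ((X n + SX n) + (Y n + SY n))) := by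
            gcongr
            refine hsh.trans ?_
            gcongr
            · exact hm n
            · exact hgrad n fx 1
            · exact hgrad n fy Complex.I
      _ = ENNReal.ofReal (K / δ n) * (4 * ENNReal.ofReal (δ n ^ 2)) +
          ENNReal.ofReal (K / δ n) * (4 * ENNReal.ofReal (δ n)) *
            ((X n + SX n) + (Y n + SY n)) := by ring
      _ = E n := by
            have hd := (hδ0 n).ne'
            have hKd : 0 ≤ K / δ n := div_nonneg hK0 (hδ0 n).le
            have h4 : (4 : ℝ≥0∞) = ENNReal.ofReal 4 := by simp
            have e1 : ENNReal.ofReal (K / δ n) * (4 * ENNReal.ofReal (δ n ^ 2)) =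
                ENNReal.ofReal (4 * K * δ n) := by
              rw [h4, ← ENNReal.ofReal_mul (by norm_num), ← ENNReal.ofReal_mul hKd]
              congr 1
              field_simp
            have e2 : ENNReal.ofReal (K / δ n) * (4 * ENNReal.ofReal (δ n)) =
                ENNReal.ofReal (4 * K) := by
              rw [h4, ← ENNReal.ofReal_mul (by norm_num), ← ENNReal.ofReal_mul hKd]
              congr 1
              field_simp
            rw [e1, e2]
  have hder : ∀ (g : L2Disk) v, ‖v‖ ≤ 1 →
      Tendsto (fun n => eLpNorm (fun z => fderiv ℝ (u n) z v - g z) 2 diskMeasure) atTop (𝓝 0) →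
      Tendsto (fun n => eLpNorm (fun z => fderiv ℝ (fun z => cutoff (δ n) z * u (m n) z) z v - g z)
        2 diskMeasure) atTop (𝓝 0) := by
    intro g v hv hg
    have hlim := ((hg.comp hmt).add (tendsto_eLpNorm_shell g hδ0 hδ)).add hEt
    rw [add_zero, add_zero] at hlim
    refine tendsto_of_tendsto_of_tendsto_of_le_of_le tendsto_const_nhds hlim
      (fun _ => zero_le) fun n => ?_
    have hdc : Continuous fun z => fderiv ℝ (u (m n)) z v :=
      ((hus (m n)).continuous_fderiv (by simp)).clm_apply continuous_const
    have hcc : Continuous fun z => ((fderiv ℝ (cutoff (δ n)) z v : ℝ) : ℂ) * u (m n) z :=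
      (Complex.continuous_ofReal.comp (((contDiff_cutoff (δ n)).continuous_fderiv
        (by simp)).clm_apply continuous_const)).mul (hus (m n)).continuous
    have heq : (fun z => fderiv ℝ (fun z => cutoff (δ n) z * u (m n) z) z v - g z) =
        (fun z => cutoff (δ n) z * fderiv ℝ (u (m n)) z v - g z) +
          fun z => fderiv ℝ (cutoff (δ n)) z v * u (m n) z := by
      ext z
      rw [fderiv_cutoff_mul _ (hus _), Pi.add_apply]
      ring
    rw [heq]
    refine (eLpNorm_add_le (((measurable_cutoff _ _).mul hdc.aestronglyMeasurable).sub
      (Lp.aestronglyMeasurable g)) hcc.aestronglyMeasurable (by simp)).trans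
      (add_le_add (eLpNorm_cutoff_mul_sub_le (hδ0 n) hdc g) (hcut n v hv))
  refine ⟨fun n z => cutoff (δ n) z * u (m n) z, fun n => isTest_cutoff_mul (hδ0 n) (hus _), ?_,
    fx, fy, hx, hy, hder fx 1 (by simp) h1, hder fy Complex.I (by simp) h2⟩
  have hlim := (h0.comp hmt).add (tendsto_eLpNorm_shell f hδ0 hδ)
  rw [add_zero] at hlim
  exact tendsto_of_tendsto_of_tendsto_of_le_of_le tendsto_const_nhds hlim
    (fun _ => zero_le) fun n => eLpNorm_cutoff_mul_sub_le (hδ0 n) (hus _).continuous f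

/-! ### The decomposition and its formulas -/

theorem hasSum_fourier_pairs {t : L2Bdry} (h0 : fourierCoeff t 0 = 0) :
    HasSum (fun k : ℕ =>
      fourierCoeff t ((k : ℤ) + 1) • (fourierLp 2 ((k : ℤ) + 1) : L2Bdry) +
      fourierCoeff t (-((k : ℤ) + 1)) • fourierLp 2 (-((k : ℤ) + 1))) t := by
  have h := (hasSum_fourier_series_L2 t).nat_add_neg
  rw [h0, zero_smul, add_zero] at h
  -- The terms n and -n are paired; the zero mode vanishes, so the index 0 is dropped and k stands
  -- for the frequency k + 1.
  have h1 := (hasSum_nat_add_iff' 1).mpr h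
  simpa [h0] using h1

theorem IsSign.hasSum_fourier (hc : IsSign c σ) {t : L2Bdry} (h0 : fourierCoeff t 0 = 0) :
    HasSum (fun k : ℕ =>
      fourierCoeff t (σ * (k + 1)) • (fourierLp 2 (σ * (k + 1)) : L2Bdry) +
      fourierCoeff t (-(σ * (k + 1))) • fourierLp 2 (-(σ * (k + 1)))) t := by
  have h := hasSum_fourier_pairs h0
  rcases hc with ⟨rfl, rfl⟩ | ⟨rfl, rfl⟩
  · simpa only [one_mul] using h
  · simpa only [neg_mul, one_mul, neg_neg, add_comm] using h

theorem IsSign.summable_fourier (hc : IsSign c σ) (t : L2Bdry) :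
    Summable fun k : ℕ =>
      fourierCoeff t (σ * (k + 1)) • (fourierLp 2 (σ * (k + 1)) : L2Bdry) := by
  refine (hasSum_fourier_series_L2 t).summable.comp_injective (i := fun k : ℕ => σ * (k + 1)) ?_
  intro j k hjk
  rcases hc with ⟨rfl, rfl⟩ | ⟨rfl, rfl⟩ <;> simp only at hjk <;> omega

theorem IsSign.fourierCoeff_zero_of_hasSum (hc : IsSign c σ) {a : ℕ → ℂ} {s : L2Bdry}
    (hs : HasSum (fun k : ℕ => a k • (fourierLp 2 (σ * (k + 1)) : L2Bdry)) s) :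
    fourierCoeff s 0 = 0 := by
  have h := hs.mapL (innerSL ℂ (fourierLp 2 0 : L2Bdry))
  have hr : innerSL ℂ (fourierLp 2 0 : L2Bdry) s = fourierCoeff s 0 := by
    rw [← fourierBasis_repr, HilbertBasis.repr_apply_apply, coe_fourierBasis, innerSL_apply_apply]
  rw [hr] at h
  refine h.unique ?_
  convert hasSum_zero with k
  have hne : (0 : ℤ) ≠ σ * (k + 1) := by
    rcases hc with ⟨rfl, rfl⟩ | ⟨rfl, rfl⟩ <;> omega
  rw [innerSL_apply_apply, inner_smul_right, orthonormal_fourier.inner_eq_zero hne, mul_zero]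

theorem mem_H1dot_of_isTrace {f : L2Disk} {t : L2Bdry} (h : IsTrace f t)
    (h0 : fourierCoeff t 0 = 0) : f ∈ H1dot :=
  ⟨h.mem_H1, t, h, by rw [← fourierCoeff_at_zero, h0]⟩

/-- By uniqueness, every trace of f has mean zero, not only the one provided by `H1dot`. -/
theorem IsTrace.fourierCoeff_zero {f : L2Disk} {t : L2Bdry} (h : IsTrace f t) (hf : f ∈ H1dot) :
    fourierCoeff t 0 = 0 := by
  obtain ⟨-, s, hs, hs0⟩ := hf
  rw [h.unique hs, fourierCoeff_at_zero, hs0]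

theorem isTrace_of_mem_H10 {f : L2Disk} (hf : f ∈ H10) : IsTrace f 0 := by
  obtain ⟨u, hu, hlim⟩ := hf
  refine ⟨u, fun n => (hu n).smooth, hlim, ?_⟩
  simp only [(hu _).bdry]
  exact tendsto_const_nhds.congr fun _ => (eLpNorm_zero_sub bdryMeasure).symm

/-- Elements of the kernel are given by the power series of their trace. -/
theorem IsTrace.ae_hasSum {f : L2Disk} {t : L2Bdry} (h : IsTrace f t) (hf : f ∈ H1dot)
    (hk : f ∈ dKer c) (hc : IsSign c σ) :
    ∀ᵐ z ∂diskMeasure,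
      HasSum (fun k : ℕ => fourierCoeff t (σ * (k + 1)) * c z ^ (k + 1)) (f z) := by
  have hs := hc.hasSum_fourier (h.fourierCoeff_zero hf)
  simp only [h.fourierCoeff_eq_zero hk hc, zero_smul, add_zero] at hs
  obtain ⟨G, hG, hGk, hae⟩ := exists_series hc (h.summable hc) hs
  -- The series built from the surviving frequencies has the same trace as f, so the difference lies
  -- in the kernel with trace zero.
  have hsub : IsTrace (f - G) 0 := by simpa using h.sub hG
  have heq := hsub.eq_zero_of_mem_dKer ((dKer c).sub_mem hk hGk) hc
  rwa [sub_eq_zero.mp heq]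

/-- The part of a trace with frequencies of one sign is the trace of an element of the kernel. -/
theorem IsTrace.exists_projection {f : L2Disk} {t : L2Bdry} (h : IsTrace f t) (hc : IsSign c σ) :
    ∃ (G : L2Disk) (s : L2Bdry), IsTrace G s ∧ G ∈ H1dot ∧ G ∈ dKer c ∧
      HasSum (fun k : ℕ =>
        fourierCoeff t (σ * (k + 1)) • (fourierLp 2 (σ * (k + 1)) : L2Bdry)) s := by
  obtain ⟨s, hs⟩ := hc.summable_fourier t
  obtain ⟨G, hG, hGk, -⟩ := exists_series hc (h.summable hc) hs
  exact ⟨G, s, hG, mem_H1dot_of_isTrace hG (hc.fourierCoeff_zero_of_hasSum hs), hGk, hs⟩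

theorem H10_le_H1dot : H10 ≤ H1dot := fun _ hf =>
  mem_H1dot_of_isTrace (isTrace_of_mem_H10 hf) (fourierCoeff_Lp_zero 0)

/-- The two kernel elements built from the negative and the positive frequencies of the trace add up
to the full trace, so the remainder has trace zero. -/
theorem exists_decomposition {g : L2Disk} (hg : g ∈ H1dot) :
    ∃ g₀ ∈ H10, ∃ gPlus ∈ H1dotKerPlus, ∃ gMinus ∈ H1dotKerMinus, g = g₀ + gPlus + gMinus := by
  obtain ⟨-, t, ht, -⟩ := id hg
  obtain ⟨P, p, hP, hPd, hPk, hp⟩ := ht.exists_projection isSign_conj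
  obtain ⟨Q, q, hQ, hQd, hQk, hq⟩ := ht.exists_projection isSign_id
  rw [dKer_conj] at hPk
  rw [dKer_id] at hQk
  simp only [neg_mul, one_mul] at hp hq
  have hsum : t = q + p := (hasSum_fourier_pairs (ht.fourierCoeff_zero hg)).unique (hq.add hp)
  have h0 : IsTrace (g - Q - P) 0 := by simpa [hsum] using (ht.sub hQ).sub hP
  exact ⟨_, h0.mem_H10, P, ⟨hPd, hPk⟩, Q, ⟨hQd, hQk⟩, by abel⟩

/-- The formulas for the components of a decomposition. -/
theorem decomposition_formula {g : L2Disk} {t : L2Bdry} (ht : IsTrace g t) {g₀ : L2Disk}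
    (h₀ : g₀ ∈ H10) {gPlus : L2Disk} (hPlus : gPlus ∈ H1dotKerPlus) {gMinus : L2Disk}
    (hMinus : gMinus ∈ H1dotKerMinus) (hg : g = g₀ + gPlus + gMinus) :
    (∀ᵐ z ∂diskMeasure, HasSum (fun k : ℕ =>
      fourierCoeff t (-((k : ℤ) + 1)) * (starRingEnd ℂ z) ^ (k + 1)) (gPlus z)) ∧
    (∀ᵐ z ∂diskMeasure,
      HasSum (fun k : ℕ => fourierCoeff t ((k : ℤ) + 1) * z ^ (k + 1)) (gMinus z)) := by
  obtain ⟨hPd, hPk⟩ := hPlus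
  obtain ⟨hQd, hQk⟩ := hMinus
  rw [SetLike.mem_coe, ← dKer_conj] at hPk
  rw [SetLike.mem_coe, ← dKer_id] at hQk
  obtain ⟨-, p, hp, -⟩ := id hPd
  obtain ⟨-, q, hq, -⟩ := id hQd
  have htr : t = p + q := by
    refine ht.unique ?_
    rw [hg]
    simpa using ((isTrace_of_mem_H10 h₀).add hp).add hq
  have hP := hp.ae_hasSum hPd hPk isSign_conj
  have hQ := hq.ae_hasSum hQd hQk isSign_id
  -- The trace p has no positive frequencies and q no negative ones, so each coefficient of t
  -- belongs to only one of them.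
  have hp0 := hp.fourierCoeff_eq_zero hPk isSign_conj
  have hq0 := hq.fourierCoeff_eq_zero hQk isSign_id
  simp only [neg_mul, one_mul, neg_neg] at hP hQ hp0 hq0
  constructor
  · filter_upwards [hP] with z hz
    simp only [htr, fourierCoeff_Lp_add, hq0, add_zero]
    exact hz
  · filter_upwards [hQ] with z hz
    simp only [htr, fourierCoeff_Lp_add, hp0, zero_add]
    exact hz

/-- The zero function has trace zero, so the formulas give both kernel parts as series with zero
coefficients. -/
theorem decomposition_zero {g₀ : L2Disk} (h₀ : g₀ ∈ H10) {gPlus : L2Disk}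
    (hPlus : gPlus ∈ H1dotKerPlus) {gMinus : L2Disk} (hMinus : gMinus ∈ H1dotKerMinus)
    (hg : g₀ + gPlus + gMinus = 0) : g₀ = 0 ∧ gPlus = 0 ∧ gMinus = 0 := by
  obtain ⟨hP, hQ⟩ := decomposition_formula IsTrace.zero h₀ hPlus hMinus hg.symm
  simp only [fourierCoeff_Lp_zero, zero_mul] at hP hQ
  have hP0 : gPlus = 0 := by
    rw [Lp.eq_zero_iff_ae_eq_zero]
    filter_upwards [hP] with z hz using hz.unique hasSum_zero
  have hQ0 : gMinus = 0 := by
    rw [Lp.eq_zero_iff_ae_eq_zero]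
    filter_upwards [hQ] with z hz using hz.unique hasSum_zero
  refine ⟨?_, hP0, hQ0⟩
  simpa [hP0, hQ0] using hg

theorem iSupIndep_fin_three_of_add_eq_zero {E : Type*} [AddCommGroup E] [Module ℂ E]
    {A B C : Submodule ℂ E}
    (h : ∀ a ∈ A, ∀ b ∈ B, ∀ c ∈ C, a + b + c = 0 → a = 0 ∧ b = 0 ∧ c = 0) :
    iSupIndep ![A, B, C] := by
  rw [iSupIndep_fin_three]
  simp only [Matrix.cons_val, Submodule.disjoint_def, Submodule.mem_sup]
  refine ⟨?_, ?_, ?_⟩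
  · rintro x hx ⟨b, hb, c, hc, rfl⟩
    simpa using (h _ hx _ (B.neg_mem hb) _ (C.neg_mem hc) (by abel)).1
  · rintro x hx ⟨c, hc, a, ha, rfl⟩
    simpa using (h _ (A.neg_mem ha) _ hx _ (C.neg_mem hc) (by abel)).2.1
  · rintro x hx ⟨a, ha, b, hb, rfl⟩
    simpa using (h _ (A.neg_mem ha) _ (B.neg_mem hb) _ hx (by abel)).2.2

end DiskSobolev

end

theorem mainTheorem10 :
    DiskSobolev.H10 ⊔ DiskSobolev.H1dotKerPlus ⊔ DiskSobolev.H1dotKerMinus = DiskSobolev.H1dot ∧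
    iSupIndep ![DiskSobolev.H10, DiskSobolev.H1dotKerPlus, DiskSobolev.H1dotKerMinus] ∧
    ∀ g ∈ DiskSobolev.H1dot, ∀ t : DiskSobolev.L2Bdry, DiskSobolev.IsTrace g t →
      HasSum (fun k : ℕ =>
          fourierCoeff t ((k : ℤ) + 1) • fourierLp 2 ((k : ℤ) + 1) +
          fourierCoeff t (-((k : ℤ) + 1)) • fourierLp 2 (-((k : ℤ) + 1))) t ∧
      Summable (fun k : ℕ =>
        (‖fourierCoeff t (-((k : ℤ) + 1))‖ ^ 2 + ‖fourierCoeff t ((k : ℤ) + 1)‖ ^ 2) *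
          (1 + ((k : ℝ) + 1))) ∧
      ∀ g₀ ∈ DiskSobolev.H10, ∀ gPlus ∈ DiskSobolev.H1dotKerPlus,
        ∀ gMinus ∈ DiskSobolev.H1dotKerMinus, g = g₀ + gPlus + gMinus →
          (∀ᵐ z ∂DiskSobolev.diskMeasure,
            HasSum (fun k : ℕ =>
              fourierCoeff t (-((k : ℤ) + 1)) * (starRingEnd ℂ z) ^ (k + 1)) (gPlus z)) ∧
          (∀ᵐ z ∂DiskSobolev.diskMeasure,
            HasSum (fun k : ℕ => fourierCoeff t ((k : ℤ) + 1) * z ^ (k + 1)) (gMinus z)) := by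
  refine ⟨le_antisymm ?_ ?_, ?_, ?_⟩
  · exact sup_le (sup_le DiskSobolev.H10_le_H1dot inf_le_left) inf_le_left
  · intro g hg
    obtain ⟨g₀, h₀, P, hP, Q, hQ, rfl⟩ := DiskSobolev.exists_decomposition hg
    exact Submodule.add_mem_sup (Submodule.add_mem_sup h₀ hP) hQ
  · exact DiskSobolev.iSupIndep_fin_three_of_add_eq_zero fun a ha b hb c hc h =>
      DiskSobolev.decomposition_zero ha hb hc h
  · intro g hg t ht
    refine ⟨DiskSobolev.hasSum_fourier_pairs (ht.fourierCoeff_zero hg), ?_,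
      fun g₀ h₀ P hP Q hQ h => DiskSobolev.decomposition_formula ht h₀ hP hQ h⟩
    have hsum := (ht.summable DiskSobolev.isSign_conj).add (ht.summable DiskSobolev.isSign_id)
    simp only [neg_mul, one_mul] at hsum
    -- The weight 1 + (k + 1) is at most twice the weight k + 1 of `IsTrace.summable`.
    refine Summable.of_nonneg_of_le (fun k => by positivity) (fun k => ?_) (hsum.mul_left 2)
    rw [← add_mul]
    have hk : (1 + ((k : ℝ) + 1)) ≤ 2 * (k + 1) := by linarith [k.cast_nonneg (α := ℝ)]
    calc _ ≤ (‖fourierCoeff t (-((k : ℤ) + 1))‖ ^ 2 + ‖fourierCoeff t ((k : ℤ) + 1)‖ ^ 2) *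
          (2 * ((k : ℝ) + 1)) := by gcongr
      _ = _ := by ring
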